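/- For $d\in\{0,1,2\}^2$ let $f_d:\mathbb{R}^2\to\mathbb{R}^2$, $f_d(x)=\frac{x+d}{3}$. For a nonempty set $\mathcal{D}\subset\{0,1,2\}^2$ let $K(3,\mathcal{D})$ denote the fractal square of order $3$ with digit set $\mathcal{D}$, i.e. the unique nonempty compact set $K\subset\mathbb{R}^2$ with $K=\bigcup_{d\in\mathcal{D}}f_d(K)$. Let $K_j=K(3,\mathcal{D}_j)$ for $4\le j\le 7$, where $$\mathcal{D}_4=\{(0,0),(1,0),(2,0),(0,2),(1,2)\},\qquad \mathcal{D}_5=\{(0,0),(1,0),(2,0),(0,2),(2,2)\},$$ $$\mathcal{D}_6=\{(0,0),(1,1),(2,2),(1,0),(0,2)\},\qquad \mathcal{D}_7=\{(0,0),(1,0),(2,0),(0,2),(2,1)\}.$$ Theorem. Let $\mathcal{D}\subset\{0,1,2\}^2$ with $\#\mathcal{D}=5$. If $K(3,\mathcal{D})$ has both a connected component that is a single point and a connected component that is a nondegenerate line segment, then $K(3,\mathcal{D})$ is homeomorphic to $K_j$ for some $j\in\{4,5,6,7\}$. Moreover, there are at most $8$ topological equivalence classes (classes up to homeomorphism)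 among all the fractal squares $K(3,\mathcal{D})$ with $\#\mathcal{D}=5$; that is, $\chi(5)\le 8$, where $\chi(q)$ denotes the number of topological equivalence classes in the family of all $K(3,\mathcal{D})$ with $\#\mathcal{D}=q$. -/

import Mathlib

open Set Topology TopologicalSpace Metric

noncomputable section

/-- The Euclidean plane. -/
abbrev Plane : Type := EuclideanSpace ℝ (Fin 2)

/-- The similitude `f_d(x) = (x + d) / N` attached to a digit `d ∈ {0, …, N-1}²`. -/
def digitMap (N : ℕ) (d : Fin N × Fin N) (x : Plane) : Plane :=
  (N : ℝ)⁻¹ • (x + !₂[((d.1 : ℕ) : ℝ), ((d.2 : ℕ) : ℝ)])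

/-- `K` is a nonempty compact set with `K = ⋃_{d ∈ D} f_d(K)`. -/
structure IsFractalSquare (N : ℕ) (D : Finset (Fin N × Fin N)) (K : Set Plane) : Prop where
  nonempty : K.Nonempty
  isCompact : IsCompact K
  eq_iUnion : K = ⋃ d ∈ D, digitMap N d '' K

theorem lipschitzWith_digitMap (N : ℕ) (d : Fin N × Fin N) :
    LipschitzWith (N : NNReal)⁻¹ (digitMap N d) := by
  refine LipschitzWith.of_dist_le_mul fun x y => ?_
  simp [digitMap, dist_smul₀]

/-- The Hutchinson map `X ↦ ⋃_{d ∈ D} f_d(X)` on nonempty compact sets. -/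
def hutchinson (N : ℕ) (D : Finset (Fin N × Fin N)) (hD : D.Nonempty)
    (X : NonemptyCompacts Plane) : NonemptyCompacts Plane where
  carrier := ⋃ d ∈ D, digitMap N d '' (X : Set Plane)
  isCompact' := D.isCompact_biUnion fun d _ =>
    X.isCompact.image (lipschitzWith_digitMap N d).continuous
  nonempty' := by
    obtain ⟨d, hd⟩ := hD
    exact ((X.nonempty.image (digitMap N d)).mono (Set.subset_biUnion_of_mem
      (u := fun d => digitMap N d '' (X : Set Plane)) (Finset.mem_coe.2 hd)))

theorem contractingWith_hutchinson (N : ℕ) (hN : 2 ≤ N) (D : Finset (Fin N × Fin N))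
    (hD : D.Nonempty) : ContractingWith (N : NNReal)⁻¹ (hutchinson N D hD) := by
  refine ⟨inv_lt_one_of_one_lt₀ (by exact_mod_cast hN), fun X Y => ?_⟩
  change hausdorffEDist (⋃ d ∈ D, digitMap N d '' (X : Set Plane))
    (⋃ d ∈ D, digitMap N d '' (Y : Set Plane)) ≤ _ * hausdorffEDist (X : Set Plane) Y
  have key : ∀ (d : Fin N × Fin N) (A B : NonemptyCompacts Plane), ∀ x ∈ digitMap N d '' (A : Set Plane),
      infEDist x (digitMap N d '' (B : Set Plane)) ≤
        ((N : NNReal)⁻¹ : NNReal) * hausdorffEDist (A : Set Plane) B := by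
    rintro d A B _ ⟨a, ha, rfl⟩
    obtain ⟨b, hb, hab⟩ := B.isCompact.exists_infEDist_eq_edist B.nonempty a
    refine (infEDist_le_edist_of_mem (mem_image_of_mem _ hb)).trans
      ((lipschitzWith_digitMap N d a b).trans ?_)
    rw [← hab]
    gcongr
    exact infEDist_le_hausdorffEDist_of_mem ha
  refine hausdorffEDist_iUnion_le.trans (iSup_le fun d =>
    hausdorffEDist_iUnion_le.trans (iSup_le fun _ => ?_))
  refine hausdorffEDist_le_of_infEDist (key d X Y) ?_
  rw [hausdorffEDist_comm]
  exact key d Y X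

/-- Existence and uniqueness of the fractal square of order `N` with digit set `D`. -/
theorem existsUnique_isFractalSquare (N : ℕ) (hN : 2 ≤ N) (D : Finset (Fin N × Fin N))
    (hD : D.Nonempty) : ∃! K : Set Plane, IsFractalSquare N D K := by
  have hc := contractingWith_hutchinson N hN D hD
  haveI : Nonempty (NonemptyCompacts Plane) := ⟨⟨⟨{0}, isCompact_singleton⟩, singleton_nonempty 0⟩⟩
  have hfix := hc.fixedPoint_isFixedPt
  refine ⟨(ContractingWith.fixedPoint _ hc : NonemptyCompacts Plane),
    ⟨NonemptyCompacts.nonempty _, NonemptyCompacts.isCompact _,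
      (congrArg (fun X : NonemptyCompacts Plane => (X : Set Plane)) hfix).symm⟩, fun K hK => ?_⟩
  have h : Function.IsFixedPt (hutchinson N D hD) ⟨⟨K, hK.isCompact⟩, hK.nonempty⟩ :=
    SetLike.coe_injective hK.eq_iUnion.symm
  exact congrArg (fun X : NonemptyCompacts Plane => (X : Set Plane)) (hc.fixedPoint_unique h)

/-- The fractal square `K(N, D)`. For `2 ≤ N` and nonempty `D` exactly one set satisfies
`IsFractalSquare N D`, and this union is that set. -/
def fractalSquare (N : ℕ) (D : Finset (Fin N × Fin N)) : Set Plane :=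
  ⋃₀ {K | IsFractalSquare N D K}

theorem IsFractalSquare.eq_fractalSquare {N : ℕ} (hN : 2 ≤ N) {D : Finset (Fin N × Fin N)}
    (hD : D.Nonempty) {K : Set Plane} (hK : IsFractalSquare N D K) : fractalSquare N D = K := by
  have h : {K | IsFractalSquare N D K} = {K} :=
    Set.eq_singleton_iff_unique_mem.2
      ⟨hK, fun _ hL => (existsUnique_isFractalSquare N hN D hD).unique hL hK⟩
  rw [fractalSquare, h, sUnion_singleton]

theorem isFractalSquare_fractalSquare (N : ℕ) (hN : 2 ≤ N) (D : Finset (Fin N × Fin N))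
    (hD : D.Nonempty) : IsFractalSquare N D (fractalSquare N D) := by
  obtain ⟨K, hK, -⟩ := existsUnique_isFractalSquare N hN D hD
  rwa [hK.eq_fractalSquare hN hD]

/-- Some connected component of `K` is a single point. -/
def HasPointComponent (K : Set Plane) : Prop :=
  ∃ x ∈ K, connectedComponentIn K x = {x}

/-- Some connected component of `K` is a (nondegenerate) line segment. -/
def HasSegmentComponent (K : Set Plane) : Prop :=
  ∃ x ∈ K, ∃ a b : Plane, a ≠ b ∧ connectedComponentIn K x = segment ℝ a b

/-- The family of all fractal squares `K(3, D)` with `#D = q`. -/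
def orderThreeFamily (q : ℕ) : Set (Set Plane) :=
  {K | ∃ D : Finset (Fin 3 × Fin 3), D.card = q ∧ K = fractalSquare 3 D}

/-- Topological equivalence (being homeomorphic) of the members of a family of plane sets. -/
def topEquiv (F : Set (Set Plane)) : Setoid F where
  r K L := Nonempty ((K : Set Plane) ≃ₜ (L : Set Plane))
  iseqv :=
    { refl := fun _ => ⟨Homeomorph.refl _⟩
      symm := fun ⟨h⟩ => ⟨h.symm⟩
      trans := fun ⟨h⟩ ⟨k⟩ => ⟨h.trans k⟩ }

/-- `χ(q)`: the number of topological equivalence classes of fractal squares `K(3, D)` with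
`#D = q`, as an extended natural number. -/
def chi (q : ℕ) : ℕ∞ := ENat.card (Quotient (topEquiv (orderThreeFamily q)))

def D4 : Finset (Fin 3 × Fin 3) := {(0, 0), (1, 0), (2, 0), (0, 2), (1, 2)}
def D5 : Finset (Fin 3 × Fin 3) := {(0, 0), (1, 0), (2, 0), (0, 2), (2, 2)}
def D6 : Finset (Fin 3 × Fin 3) := {(0, 0), (1, 1), (2, 2), (1, 0), (0, 2)}
def D7 : Finset (Fin 3 × Fin 3) := {(0, 0), (1, 0), (2, 0), (0, 2), (2, 1)}

end

/-! A digit set with a full row gives segments in every cell. When the components of `K` are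
horizontal and no second row is full, they are points and arcs, only finitely many exceed a given
size, and every nonempty open set contains two distinct arc components. These properties
(`IsDecorated`) determine a nonempty compact metric space up to homeomorphism, so all such fractal
squares, those of `D4`, `D5` and `D7` included, form one topological class.

For this uniqueness (`IsDecorated.nonempty_homeomorph`), take a largest component of a clopen set,
cut the rest into small clopen pieces converging to it, and repeat inside each piece. The points
where the pieces converge can be rearranged to follow any prescribed sequence accumulating
everywhere (`exists_bijective_dist_lt`). The resulting tree then has a combinatorial form
independent of the space, and the itineraries of points through it identify any two such spaces.
With one-point components the same argument is Brouwer's characterization of the Cantor set.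

Components are located by finite certificates. If an integer linear form, corrected by a function of
the last three digits, agrees on all touching cells of equal size, rescaling makes the form constant
on connected sets (`linear_eq_of_isPreconnected`). That large arcs are finitely many follows because
a line across a column of cells can only have the height of a full-row segment
(`eq_add_half_of_stacked`).

A finite check reduces the 126 digit sets to arc-decorated ones, Cantor sets, five connected ones
and `D6`. This gives at most 1 + 1 + 5 + 1 = 8 classes. A segment component excludes the Cantor sets
and a point component excludes the connected squares, which leaves the arc-decorated class and `D6`.
-/

/-! ### Decoration trees and their itineraries -/

/-- A hierarchical decomposition of `X` along embedded copies `γ w` of `I`: the clopen set `Q w`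
is the disjoint union of `range (γ w)` and clopen sets `Q (k :: w)` clustering at
`γ w (τ k)`. -/
structure DecorationTree (I X : Type*) [MetricSpace I] [MetricSpace X] (τ : ℕ → I) where
  Q : List ℕ → Set X
  γ : List ℕ → I → X
  nil_eq : Q [] = univ
  isClopen : ∀ w, IsClopen (Q w)
  nonempty : ∀ w, (Q w).Nonempty
  continuous : ∀ w, Continuous (γ w)
  injective : ∀ w, Function.Injective (γ w)
  eq_union : ∀ w, Q w = range (γ w) ∪ ⋃ k, Q (k :: w)
  disjoint_range : ∀ w k, Disjoint (range (γ w)) (Q (k :: w))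
  disjoint_child : ∀ w k l, k ≠ l → Disjoint (Q (k :: w)) (Q (l :: w))
  cluster : ∀ w, ∀ ε > 0, ∀ᶠ k in Filter.atTop, Q (k :: w) ⊆ ball (γ w (τ k)) ε
  diam_lt : ∀ w : ℕ → List ℕ, w 0 = [] → (∀ n, ∃ k, w (n + 1) = k :: w n) →
    ∀ ε > 0, ∃ n, diam (Q (w n)) < ε

namespace DecorationTree

variable {I X Y : Type*} [MetricSpace I] [MetricSpace X] [MetricSpace Y] {τ : ℕ → I}

theorem child_subset (T : DecorationTree I X τ) (w : List ℕ) (k : ℕ) : T.Q (k :: w) ⊆ T.Q w := by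
  rw [T.eq_union w]
  exact (subset_iUnion (fun k => T.Q (k :: w)) k).trans subset_union_right

theorem range_subset (T : DecorationTree I X τ) (w : List ℕ) : range (T.γ w) ⊆ T.Q w := by
  rw [T.eq_union w]
  exact subset_union_left

theorem subset_of_suffix (T : DecorationTree I X τ) {v w : List ℕ} (h : v <:+ w) :
    T.Q w ⊆ T.Q v := by
  obtain ⟨u, rfl⟩ := h
  induction u with
  | nil => exact Subset.rfl
  | cons k u ih => exact (T.child_subset _ k).trans ih

/-- Siblings are disjoint, so a point belongs to at most one node at each depth. -/
theorem eq_of_mem (T : DecorationTree I X τ) {x : X} :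
    ∀ {v w : List ℕ}, x ∈ T.Q v → x ∈ T.Q w → v.length = w.length → v = w
  | [], [], _, _, _ => rfl
  | [], _ :: _, _, _, h => by simp at h
  | _ :: _, [], _, _, h => by simp at h
  | k :: v, l :: w, hv, hw, h => by
    have e : v = w := eq_of_mem T (T.child_subset _ _ hv) (T.child_subset _ _ hw) (by simpa using h)
    subst e
    by_cases hkl : k = l
    · rw [hkl]
    · exact absurd hw (disjoint_left.1 (T.disjoint_child v k l hkl) hv)

theorem not_mem_child (T : DecorationTree I X τ) {x : X} {w : List ℕ} (hx : x ∈ range (T.γ w))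
    (k : ℕ) : x ∉ T.Q (k :: w) :=
  disjoint_left.1 (T.disjoint_range w k) hx

/-- Words grow at the head, so suffixes are ancestors. A longer word whose node contained the point
would pass through a child of `w`, and children avoid the copy at `w`. -/
theorem mem_iff_suffix (T : DecorationTree I X τ) (w : List ℕ) (t : I) (v : List ℕ) :
    T.γ w t ∈ T.Q v ↔ v <:+ w := by
  have hw : T.γ w t ∈ T.Q w := T.range_subset w (mem_range_self t)
  refine ⟨fun h => ?_, fun h => T.subset_of_suffix h hw⟩
  rcases le_or_gt v.length w.length with hl | hl
  · have hs : w.drop (w.length - v.length) <:+ w := List.drop_suffix _ _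
    have := T.eq_of_mem h (T.subset_of_suffix hs hw) (by simp; omega)
    rwa [← this] at hs
  · exfalso
    have hs : v.drop (v.length - w.length) <:+ v := List.drop_suffix _ _
    have e := T.eq_of_mem (T.subset_of_suffix hs h) hw (by simp; omega)
    have hs' : v.drop (v.length - w.length - 1) <:+ v := List.drop_suffix _ _
    have hc := List.drop_eq_getElem_cons (l := v) (i := v.length - w.length - 1) (by omega)
    rw [show v.length - w.length - 1 + 1 = v.length - w.length by omega, e] at hc
    rw [hc] at hs'
    exact T.not_mem_child (mem_range_self t) _ (T.subset_of_suffix hs' h)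

theorem exists_child_of_not_mem_range (T : DecorationTree I X τ) {x : X} {w : List ℕ}
    (hx : x ∈ T.Q w) (h : x ∉ range (T.γ w)) : ∃ k, x ∈ T.Q (k :: w) := by
  rw [T.eq_union w] at hx
  simpa using hx.resolve_left h

open Classical in
/-- The coordinate of a point at the node `w`. -/
noncomputable def coord (T : DecorationTree I X τ) (w : List ℕ) (x : X) : I :=
  if h : x ∈ range (T.γ w) then h.choose
  -- A child is collapsed to the parameter at which it clusters, which keeps the coordinate
  -- continuous. Outside `Q w` the constant `τ 0` is arbitrary.
  else if h : ∃ k, x ∈ T.Q (k :: w) then τ h.choose else τ 0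

theorem coord_γ (T : DecorationTree I X τ) (w : List ℕ) (t : I) : T.coord w (T.γ w t) = t := by
  have h : T.γ w t ∈ range (T.γ w) := mem_range_self t
  rw [coord, dif_pos h]
  exact T.injective w h.choose_spec

theorem coord_child (T : DecorationTree I X τ) {w : List ℕ} {k : ℕ} {x : X}
    (h : x ∈ T.Q (k :: w)) : T.coord w x = τ k := by
  have h1 : x ∉ range (T.γ w) := fun h' => T.not_mem_child h' k h
  have h2 : ∃ k, x ∈ T.Q (k :: w) := ⟨k, h⟩
  rw [coord, dif_neg h1, dif_pos h2]
  have := T.eq_of_mem h2.choose_spec h rfl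
  simp only [List.cons.injEq, and_true] at this
  rw [this]

theorem coord_of_not_mem (T : DecorationTree I X τ) {w : List ℕ} {x : X} (h : x ∉ T.Q w) :
    T.coord w x = τ 0 := by
  have h1 : x ∉ range (T.γ w) := fun h' => h (T.range_subset w h')
  have h2 : ¬ ∃ k, x ∈ T.Q (k :: w) := fun ⟨k, hk⟩ => h (T.child_subset w k hk)
  rw [coord, dif_neg h1, dif_neg h2]

/-- Away from the copy of `I` the coordinate is locally constant. Near `γ w t`, a neighbourhood
avoids the finitely many children that are not small. Any other child it meets clusters at a point
near `γ w t`, and the embedding `γ w` has continuous inverse. -/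
theorem continuous_coord [CompactSpace I] (T : DecorationTree I X τ) (w : List ℕ) :
    Continuous (T.coord w) := by
  have key : ∀ {s : Set X} {c : I}, IsOpen s → (∀ y ∈ s, T.coord w y = c) → ∀ x ∈ s,
      ContinuousAt (T.coord w) x := fun {s c} hs hc x hx =>
    (continuousAt_const (y := c)).congr
      (Filter.mem_of_superset (hs.mem_nhds hx) fun y hy => (hc y hy).symm)
  refine continuous_iff_continuousAt.2 fun x => ?_
  by_cases hxQ : x ∈ T.Q w
  swap
  · exact key (T.isClopen w).compl.isOpen (fun y hy => T.coord_of_not_mem hy) x hxQ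
  by_cases hx : x ∈ range (T.γ w)
  swap
  · obtain ⟨k, hk⟩ := T.exists_child_of_not_mem_range hxQ hx
    exact key (T.isClopen _).isOpen (fun y hy => T.coord_child hy) x hk
  obtain ⟨t, rfl⟩ := hx
  rw [Metric.continuousAt_iff']
  intro ε hε
  have hemb := ((T.continuous w).isClosedEmbedding (T.injective w)).isEmbedding
  have : ball t ε ∈ (𝓝 (T.γ w t)).comap (T.γ w) := by
    rw [← hemb.nhds_eq_comap]; exact ball_mem_nhds t hε
  obtain ⟨V, hV, hVs⟩ := Filter.mem_comap.1 this
  obtain ⟨η, hη, hηV⟩ := Metric.mem_nhds_iff.1 hV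
  obtain ⟨N, hN⟩ := Filter.eventually_atTop.1 (T.cluster w (η / 2) (by positivity))
  have hopen : ∀ᶠ y in 𝓝 (T.γ w t), ∀ k ∈ Finset.range N, y ∉ T.Q (k :: w) :=
    (Filter.eventually_all_finset _).2 fun k _ =>
      (T.isClopen _).compl.isOpen.mem_nhds (T.not_mem_child (mem_range_self t) k)
  filter_upwards [hopen, (T.isClopen w).isOpen.mem_nhds hxQ, ball_mem_nhds _ (half_pos hη)]
    with y h1 h2 h3
  rw [T.coord_γ]
  by_cases hy : y ∈ range (T.γ w)
  · obtain ⟨s, rfl⟩ := hy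
    rw [T.coord_γ]
    exact hVs (hηV (ball_subset_ball (by linarith) h3))
  · obtain ⟨k, hk⟩ := T.exists_child_of_not_mem_range h2 hy
    have hkN : N ≤ k := by
      by_contra h
      exact h1 k (Finset.mem_range.2 (not_le.1 h)) hk
    have h4 := hN k hkN hk
    rw [T.coord_child hk]
    refine hVs (hηV ?_)
    rw [mem_ball] at *
    linarith [dist_triangle_left (T.γ w (τ k)) (T.γ w t) y]

open Classical in
/-- The itinerary of a point. -/
noncomputable def itinerary (T : DecorationTree I X τ) (x : X) (w : List ℕ) : Bool × I :=
  (decide (x ∈ T.Q w), T.coord w x)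

theorem continuous_itinerary [CompactSpace I] (T : DecorationTree I X τ) :
    Continuous T.itinerary := by
  classical
  refine continuous_pi fun w => Continuous.prodMk ?_ (T.continuous_coord w)
  refine continuous_discrete_rng.2 fun b => ?_
  cases b
  · convert (T.isClopen w).compl.isOpen using 1
    ext x; simp
  · convert (T.isClopen w).isOpen using 1
    ext x; simp

theorem mem_iff_of_itinerary_eq {T : DecorationTree I X τ} {T' : DecorationTree I Y τ} {x : X}
    {y : Y} (h : T.itinerary x = T'.itinerary y) (w : List ℕ) : x ∈ T.Q w ↔ y ∈ T'.Q w := by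
  have := congrArg Prod.fst (congrFun h w)
  simpa [itinerary] using this

theorem coord_eq_of_itinerary_eq {T : DecorationTree I X τ} {T' : DecorationTree I Y τ} {x : X}
    {y : Y} (h : T.itinerary x = T'.itinerary y) (w : List ℕ) : T.coord w x = T'.coord w y :=
  congrArg Prod.snd (congrFun h w)

theorem mem_range_of_mem_iff {T : DecorationTree I X τ} {T' : DecorationTree I Y τ} {x : X} {y : Y}
    (h : ∀ w, x ∈ T.Q w ↔ y ∈ T'.Q w) {w : List ℕ} (hx : x ∈ range (T.γ w)) :
    y ∈ range (T'.γ w) := by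
  by_contra hy
  obtain ⟨k, hk⟩ := T'.exists_child_of_not_mem_range ((h w).1 (T.range_subset w hx)) hy
  exact T.not_mem_child hx k ((h _).2 hk)

/-- Membership in all nodes fixes every coordinate except at a node whose copy of `I` carries the
point. -/
theorem itinerary_eq_of_mem_iff {T : DecorationTree I X τ} {T' : DecorationTree I Y τ} {x : X}
    {y : Y} (h : ∀ w, x ∈ T.Q w ↔ y ∈ T'.Q w)
    (hc : ∀ w, x ∈ range (T.γ w) → T.coord w x = T'.coord w y) :
    T.itinerary x = T'.itinerary y := by
  classical
  funext w
  refine Prod.ext ?_ ?_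
  · simp [itinerary, h w]
  · change T.coord w x = T'.coord w y
    by_cases hx : x ∈ range (T.γ w)
    · exact hc w hx
    by_cases hq : x ∈ T.Q w
    · obtain ⟨k, hk⟩ := T.exists_child_of_not_mem_range hq hx
      rw [T.coord_child hk, T'.coord_child ((h _).1 hk)]
    · rw [T.coord_of_not_mem hq, T'.coord_of_not_mem (mt (h w).2 hq)]

theorem exists_branch (T : DecorationTree I X τ) {x : X} (hx : ∀ w, x ∉ range (T.γ w)) :
    ∃ w : ℕ → List ℕ, w 0 = [] ∧ (∀ n, ∃ k, w (n + 1) = k :: w n) ∧ ∀ n, x ∈ T.Q (w n) := by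
  have hstep : ∀ v : {v // x ∈ T.Q v}, ∃ k, x ∈ T.Q (k :: v.1) := fun v =>
    T.exists_child_of_not_mem_range v.2 (hx v.1)
  choose f hf using hstep
  let g : ℕ → {v // x ∈ T.Q v} := fun n =>
    Nat.rec ⟨[], by rw [T.nil_eq]; exact mem_univ x⟩ (fun _ v => ⟨f v :: v.1, hf v⟩) n
  exact ⟨fun n => (g n).1, rfl, fun n => ⟨f (g n), rfl⟩, fun n => (g n).2⟩

/-- A point on a copy is recovered from its node and parameter; any other point follows an infinite
branch, whose nodes become arbitrarily small. -/
theorem injective_itinerary [CompactSpace X] (T : DecorationTree I X τ) :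
    Function.Injective T.itinerary := by
  intro x y h
  by_cases hx : ∃ w, x ∈ range (T.γ w)
  · obtain ⟨w, hw⟩ := hx
    obtain ⟨s, rfl⟩ := mem_range_of_mem_iff (mem_iff_of_itinerary_eq h) hw
    obtain ⟨t, rfl⟩ := hw
    have := coord_eq_of_itinerary_eq h w
    rw [T.coord_γ, T.coord_γ] at this
    rw [this]
  · obtain ⟨w, h0, hs, hm⟩ := T.exists_branch (not_exists.1 hx)
    refine eq_of_forall_dist_le fun ε hε => ?_
    obtain ⟨n, hn⟩ := T.diam_lt w h0 hs ε hε
    exact (dist_le_diam_of_mem (isCompact_univ.isBounded.subset (subset_univ _)) (hm n)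
      ((mem_iff_of_itinerary_eq h _).1 (hm n))).trans hn.le

/-- The itineraries that occur depend only on `I` and `τ`: they come from pairs of a node and a
parameter, or from infinite branches, each of which is realized by compactness. -/
theorem range_itinerary_subset [CompactSpace Y] (T : DecorationTree I X τ)
    (T' : DecorationTree I Y τ) : range T.itinerary ⊆ range T'.itinerary := by
  rintro _ ⟨x, rfl⟩
  by_cases hx : ∃ w, x ∈ range (T.γ w)
  · obtain ⟨w, t, rfl⟩ := hx
    refine ⟨T'.γ w t, (itinerary_eq_of_mem_iff (fun v => ?_) fun v hv => ?_).symm⟩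
    · rw [T.mem_iff_suffix, T'.mem_iff_suffix]
    · have h1 : v <:+ w := (T.mem_iff_suffix w t v).1 (T.range_subset v hv)
      have h2 : w <:+ v := by
        obtain ⟨s, hs⟩ := hv
        exact (T.mem_iff_suffix v s w).1 (hs ▸ T.range_subset w (mem_range_self t))
      obtain rfl : v = w := h1.eq_of_length_le h2.length_le
      rw [T.coord_γ, T'.coord_γ]
  · obtain ⟨w, h0, hs, hm⟩ := T.exists_branch (not_exists.1 hx)
    obtain ⟨y, hy⟩ := IsCompact.nonempty_iInter_of_sequence_nonempty_isCompact_isClosed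
      (fun n => T'.Q (w n)) (fun n => by
        obtain ⟨k, hk⟩ := hs n
        rw [hk]
        exact T'.child_subset _ _) (fun n => T'.nonempty _) (T'.isClopen _).isClosed.isCompact
      (fun n => (T'.isClopen _).isClosed)
    rw [mem_iInter] at hy
    have hlen : ∀ n, (w n).length = n := fun n => by
      induction n with
      | zero => simp [h0]
      | succ n ih => obtain ⟨k, hk⟩ := hs n; simp [hk, ih]
    refine ⟨y, (itinerary_eq_of_mem_iff (fun v => ⟨fun h => ?_, fun h => ?_⟩) fun v hv =>
      absurd ⟨v, hv⟩ hx).symm⟩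
    · rw [T.eq_of_mem h (hm v.length) (hlen _).symm]; exact hy _
    · rw [T'.eq_of_mem h (hy v.length) (hlen _).symm]; exact hm _

/-- Two spaces with decoration trees of the same kind are homeomorphic. -/
theorem nonempty_homeomorph [CompactSpace I] [CompactSpace X] [CompactSpace Y]
    (T : DecorationTree I X τ) (T' : DecorationTree I Y τ) : Nonempty (X ≃ₜ Y) := by
  have e := (T.continuous_itinerary.isClosedEmbedding T.injective_itinerary).isEmbedding
  have e' := (T'.continuous_itinerary.isClosedEmbedding T'.injective_itinerary).isEmbedding
  exact ⟨(e.toHomeomorph.trans (Homeomorph.setCongr ((T.range_itinerary_subset T').antisymm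
    (T'.range_itinerary_subset T)))).trans e'.toHomeomorph.symm⟩

end DecorationTree

/-! ### Decorated spaces -/

/-- A component which is an embedded copy of `I`. -/
def IsCopyComponent (I : Type*) {X : Type*} [TopologicalSpace I] [TopologicalSpace X]
    (S : Set X) : Prop :=
  (∃ x, S = connectedComponent x) ∧ ∃ γ : I → X, Continuous γ ∧ Function.Injective γ ∧ range γ = S

/-- The components of `X` are points and copies of `I`; they form a null family, and copies of `I`
are everywhere dense. -/
structure IsDecorated (I X : Type*) [MetricSpace I] [MetricSpace X] : Prop where
  component : ∀ x : X, (connectedComponent x).Subsingleton ∨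
    IsCopyComponent I (connectedComponent x)
  null : ∀ ε > 0, {S : Set X | (∃ x, S = connectedComponent x) ∧ ε ≤ diam S}.Finite
  dense : ∀ U : Set X, IsOpen U → U.Nonempty → ∃ S T : Set X, S ≠ T ∧
    IsCopyComponent I S ∧ IsCopyComponent I T ∧ S ⊆ U ∧ T ⊆ U

/-! ### Clopen neighbourhoods of components -/

section Clopen

variable {X : Type*}

theorem exists_isClopen_connectedComponent_subset [TopologicalSpace X] [T2Space X] [CompactSpace X]
    {x : X} {U : Set X} (hU : IsOpen U) (h : connectedComponent x ⊆ U) :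
    ∃ P, IsClopen P ∧ x ∈ P ∧ P ⊆ U := by
  rw [connectedComponent_eq_iInter_isClopen] at h
  have : Nonempty {s : Set X // IsClopen s ∧ x ∈ s} := ⟨⟨univ, isClopen_univ, mem_univ x⟩⟩
  obtain ⟨s, hs⟩ := exists_subset_nhds_of_isCompact'
    (V := fun s : {s : Set X // IsClopen s ∧ x ∈ s} => s.1)
    (fun s t => ⟨⟨s.1 ∩ t.1, s.2.1.inter t.2.1, s.2.2, t.2.2⟩, inter_subset_left,
      inter_subset_right⟩) (fun s => s.2.1.isClosed.isCompact) (fun s => s.2.1.isClosed)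
    (U := U) fun y hy => hU.mem_nhds (h hy)
  exact ⟨s.1, s.2.1, s.2.2, hs⟩

theorem exists_finite_clopen_disjoint_refinement [TopologicalSpace X] (s : Finset X)
    (P : X → Set X) (hP : ∀ x ∈ s, IsClopen (P x)) :
    ∃ 𝒬 : Set (Set X), 𝒬.Finite ∧ (∀ q ∈ 𝒬, IsClopen q ∧ q.Nonempty ∧ ∃ x ∈ s, q ⊆ P x) ∧
      𝒬.PairwiseDisjoint id ∧ ⋃₀ 𝒬 = ⋃ x ∈ s, P x := by
  classical
  induction s using Finset.induction_on with
  | empty => exact ⟨∅, finite_empty, by simp, by simp, by simp⟩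
  | insert a s ha ih =>
    obtain ⟨𝒬, hf, hq, hd, hU⟩ := ih fun x hx => hP x (Finset.mem_insert_of_mem hx)
    have hU' : IsClopen (⋃ x ∈ s, P x) :=
      s.finite_toSet.isClopen_biUnion fun x hx => hP x (Finset.mem_insert_of_mem hx)
    set A := P a \ ⋃ x ∈ s, P x with hA
    have hAc : IsClopen A := (hP a (Finset.mem_insert_self _ _)).diff hU'
    have hq' : ∀ q ∈ 𝒬, IsClopen q ∧ q.Nonempty ∧ ∃ x ∈ insert a s, q ⊆ P x := fun q hqQ => by
      obtain ⟨h1, h2, x, hx, h3⟩ := hq q hqQ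
      exact ⟨h1, h2, x, Finset.mem_insert_of_mem hx, h3⟩
    have hun : (⋃ x ∈ insert a s, P x) = A ∪ ⋃ x ∈ s, P x := by
      rw [Finset.set_biUnion_insert, hA, sdiff_union_self]
    rcases A.eq_empty_or_nonempty with h | h
    · exact ⟨𝒬, hf, hq', hd, by rw [hun, h, hU, empty_union]⟩
    · refine ⟨insert A 𝒬, hf.insert _, ?_, ?_, by rw [hun, sUnion_insert, hU]⟩
      · rintro q (rfl | hqQ)
        · exact ⟨hAc, h, a, Finset.mem_insert_self _ _, sdiff_subset⟩
        · exact hq' q hqQ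
      · refine hd.insert fun q hqQ _ => ?_
        refine disjoint_left.2 fun y hy hyq => hy.2 ?_
        rw [← hU]
        exact ⟨q, hqQ, hyq⟩

/-- In a compact space a component is the intersection of its clopen neighbourhoods, so one of them
has diameter at most `η` larger. Finitely many of these cover `L` and can be made disjoint. -/
theorem exists_finite_clopen_partition [MetricSpace X] [CompactSpace X] {L : Set X}
    (hL : IsClopen L) {η : ℝ} (hη : 0 < η) :
    ∃ 𝒬 : Set (Set X), 𝒬.Finite ∧
      (∀ q ∈ 𝒬, IsClopen q ∧ q.Nonempty ∧ ∃ x ∈ L, diam q ≤ diam (connectedComponent x) + η) ∧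
      𝒬.PairwiseDisjoint id ∧ ⋃₀ 𝒬 = L := by
  have hb : ∀ s : Set X, Bornology.IsBounded s := fun s =>
    isCompact_univ.isBounded.subset (subset_univ s)
  have h : ∀ x ∈ L, ∃ P, IsClopen P ∧ x ∈ P ∧ P ⊆ L ∧
      diam P ≤ diam (connectedComponent x) + η := fun x hx => by
    obtain ⟨P, hP, hxP, hPU⟩ := exists_isClopen_connectedComponent_subset
      (isOpen_thickening (δ := η / 2) (E := connectedComponent x))
      (self_subset_thickening (by positivity) _)
    refine ⟨P ∩ L, hP.inter hL, ⟨hxP, hx⟩, inter_subset_right, ?_⟩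
    refine (diam_mono (inter_subset_left.trans hPU) (hb _)).trans ?_
    refine (diam_thickening_le _ (by positivity)).trans (by linarith)
  choose! P hP hxP hPL hdiam using h
  obtain ⟨s, hsL, hs⟩ := hL.isClosed.isCompact.elim_nhds_subcover P
    fun x hx => (hP x hx).isOpen.mem_nhds (hxP x hx)
  obtain ⟨𝒬, hf, hq, hd, hU⟩ := exists_finite_clopen_disjoint_refinement s P
    fun x hx => hP x (hsL x hx)
  refine ⟨𝒬, hf, fun q hqQ => ?_, hd, hU.trans (Subset.antisymm ?_ hs)⟩
  · obtain ⟨h1, h2, x, hx, h3⟩ := hq q hqQ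
    exact ⟨h1, h2, x, hsL x hx, (diam_mono h3 (hb _)).trans (hdiam x (hsL x hx))⟩
  · exact iUnion₂_subset fun x hx => hPL x (hsL x hx)

end Clopen

/-! ### Matching accumulating sequences -/

section Matching

variable {I : Type*} [PseudoMetricSpace I]

/-- Each sequence can be injected into the other with errors tending to zero. The Schröder–Bernstein
construction uses only pairs from these two injections, so the bijection keeps the errors small. -/
theorem exists_bijective_dist_lt (f g : ℕ → I)
    (hf : ∀ s, ∀ ε > 0, {n | dist (f n) s < ε}.Infinite)
    (hg : ∀ s, ∀ ε > 0, {n | dist (g n) s < ε}.Infinite) :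
    ∃ h : ℕ → ℕ, Function.Bijective h ∧
      ∀ ε > 0, ∀ᶠ n in Filter.atTop, dist (f n) (g (h n)) < ε := by
  have key : ∀ u v : ℕ → I, (∀ s, ∀ ε > 0, {n | dist (v n) s < ε}.Infinite) →
      ∃ φ : ℕ → ℕ, Function.Injective φ ∧ ∀ n, dist (v (φ n)) (u n) < 1 / (n + 1 : ℝ) := by
    intro u v hv
    obtain ⟨φ, hφ, h⟩ := Filter.extraction_forall_of_frequently
      (P := fun n m => dist (v m) (u n) < 1 / (n + 1 : ℝ)) fun n =>
        Nat.frequently_atTop_iff_infinite.2 (hv (u n) _ Nat.one_div_pos_of_nat)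
    exact ⟨φ, hφ.injective, h⟩
  obtain ⟨φ, hφ, hφd⟩ := key f g hg
  obtain ⟨ψ, hψ, hψd⟩ := key g f hf
  obtain ⟨h, hb, hR⟩ := Function.Embedding.schroeder_bernstein_of_rel hφ hψ
    (fun a b => dist (f a) (g b) < 1 / (a + 1 : ℝ) ∨ dist (f a) (g b) < 1 / (b + 1 : ℝ))
    (fun a => Or.inl (by rw [dist_comm]; exact hφd a)) (fun b => Or.inr (hψd b))
  refine ⟨h, hb, fun ε hε => ?_⟩
  have h1 := (tendsto_order.1 tendsto_one_div_add_atTop_nhds_zero_nat).2 ε hε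
  -- The error may be controlled by `h n` instead of `n`; injectivity makes `h n` tend to infinity.
  have h2 := (hb.1.nat_tendsto_atTop).eventually h1
  filter_upwards [h1, h2] with n hn hn'
  rcases hR n with h | h
  · exact h.trans hn
  · exact h.trans hn'

/-- A dense sequence in which every term is repeated infinitely often also serves isolated points,
in particular a one-point `I`. -/
theorem exists_accumulating_sequence (I : Type*) [PseudoMetricSpace I] [SeparableSpace I]
    [Nonempty I] : ∃ τ : ℕ → I, ∀ s, ∀ ε > 0, {n | dist (τ n) s < ε}.Infinite := by
  refine ⟨fun n => denseSeq I n.unpair.1, fun s ε hε => ?_⟩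
  obtain ⟨k, hk⟩ := (denseRange_denseSeq I).exists_dist_lt s hε
  refine infinite_of_injective_forall_mem (f := fun m => Nat.pair k m) (fun a b h => ?_) fun m => ?_
  · exact (Nat.pair_eq_pair.1 h).2
  · simpa [dist_comm] using hk

end Matching

/-! ### Clopen pieces around a largest component -/

section Decompose

variable {I X : Type*} [MetricSpace X]

/-- Clopen neighbourhoods `G n` shrink to the component; the layers between successive ones
partition its complement in `Q`. Components in late layers are small by `null`, so cutting each
layer into pieces hardly larger than components leaves finitely many pieces that are not both small
and close to the component. -/
theorem exists_clopen_decomposition [CompactSpace X]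
    (null : ∀ ε > 0, {S : Set X | (∃ x, S = connectedComponent x) ∧ ε ≤ diam S}.Finite)
    {Q : Set X} (hQ : IsClopen Q) (x₀ : X) {M δ : ℝ} (hδ : 0 < δ)
    (hM : ∀ x ∈ Q, diam (connectedComponent x) ≤ M) :
    ∃ 𝒬 : Set (Set X), 𝒬.Countable ∧
      (∀ q ∈ 𝒬, IsClopen q ∧ q.Nonempty ∧ diam q ≤ M + δ) ∧ 𝒬.PairwiseDisjoint id ∧
      ⋃₀ 𝒬 = Q \ connectedComponent x₀ ∧
      ∀ ε > 0, {q ∈ 𝒬 | ¬ ∃ s ∈ connectedComponent x₀, q ⊆ ball s ε}.Finite := by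
  have hb : ∀ s : Set X, Bornology.IsBounded s := fun s =>
    isCompact_univ.isBounded.subset (subset_univ s)
  set S := connectedComponent x₀ with hS
  have hG : ∀ n : ℕ, ∃ G, IsClopen G ∧ x₀ ∈ G ∧ G ⊆ thickening (1 / (n + 1 : ℝ)) S := fun n =>
    exists_isClopen_connectedComponent_subset isOpen_thickening
      (self_subset_thickening Nat.one_div_pos_of_nat _)
  choose G hGc hGx hGt using hG
  have hSG : ∀ n, S ⊆ G n := fun n => (hGc n).connectedComponent_subset (hGx n)
  let P : ℕ → Set X := fun n => Q ∩ ⋂ i ∈ Finset.range n, G i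
  have hP : ∀ n, IsClopen (P n) := fun n =>
    hQ.inter ((Finset.range n).finite_toSet.isClopen_biInter fun i _ => hGc i)
  have hPG : ∀ {m n}, m < n → P n ⊆ G m := fun h =>
    inter_subset_right.trans (biInter_subset_of_mem (Finset.mem_range.2 h))
  let L : ℕ → Set X := fun n => P n \ G n
  have hL : ∀ n, IsClopen (L n) := fun n => (hP n).diff (hGc n)
  have hLQ : ∀ n, L n ⊆ Q := fun n x hx => hx.1.1
  have hLS : ∀ n, ∀ x ∈ L n, x ∉ S := fun n x hx h => hx.2 (hSG n h)
  have hcov : ∀ y ∈ Q, y ∉ S → ∃ n, y ∈ L n := by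
    classical
    intro y hyQ hyS
    have hex : ∃ n, y ∉ G n := by
      by_contra! h
      refine hyS ?_
      rw [hS, ← isClosed_connectedComponent.closure_eq, Metric.mem_closure_iff]
      intro ε hε
      obtain ⟨n, hn⟩ := exists_nat_one_div_lt hε
      obtain ⟨s, hs, hd⟩ := mem_thickening_iff.1 (hGt n (h n))
      exact ⟨s, hs, hd.trans hn⟩
    refine ⟨Nat.find hex, ⟨hyQ, mem_iInter₂.2 fun i hi => ?_⟩, Nat.find_spec hex⟩
    exact not_not.1 (Nat.find_min hex (Finset.mem_range.1 hi))
  -- The bound `δ` serves the uniform diameter estimate, and `1 / (n + 1)` makes the excess over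
  -- component size vanish in late layers.
  have hpart := fun n : ℕ => exists_finite_clopen_partition (hL n)
    (η := min δ (1 / (n + 1 : ℝ))) (lt_min hδ Nat.one_div_pos_of_nat)
  choose 𝒬 hfin hq hdis hun using hpart
  have hsub : ∀ n, ∀ q ∈ 𝒬 n, q ⊆ L n := fun n q h => by
    rw [← hun n]; exact subset_sUnion_of_mem h
  refine ⟨⋃ n, 𝒬 n, countable_iUnion fun n => (hfin n).countable, ?_, ?_, ?_, ?_⟩
  · intro q hqQ
    obtain ⟨n, hn⟩ := mem_iUnion.1 hqQ
    obtain ⟨h1, h2, x, hx, h3⟩ := hq n q hn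
    exact ⟨h1, h2, h3.trans (add_le_add (hM x (hLQ n hx)) (min_le_left _ _))⟩
  · intro q hqQ q' hqQ' hne
    obtain ⟨n, hn⟩ := mem_iUnion.1 hqQ
    obtain ⟨m, hm⟩ := mem_iUnion.1 hqQ'
    have hlt : ∀ {a b : ℕ} {u v : Set X}, u ∈ 𝒬 a → v ∈ 𝒬 b → a < b → Disjoint u v :=
      fun ha hb' hab => disjoint_left.2 fun y hy hy' =>
        (hsub _ _ ha hy).2 (hPG hab (hsub _ _ hb' hy').1)
    rcases lt_trichotomy n m with h | rfl | h
    · exact hlt hn hm h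
    · exact hdis n hn hm hne
    · exact (hlt hm hn h).symm
  · ext y
    rw [sUnion_iUnion, mem_iUnion]
    refine ⟨fun ⟨n, hn⟩ => ?_, fun hy => ?_⟩
    · rw [hun n] at hn
      exact ⟨hLQ n hn, hLS n y hn⟩
    · obtain ⟨n, hn⟩ := hcov y hy.1 hy.2
      exact ⟨n, by rwa [hun n]⟩
  · intro ε hε
    -- Layers are clopen, hence contain whole components; each of the finitely many large components
    -- is absent from all late layers.
    have hev : ∀ᶠ n in Filter.atTop, ∀ x ∈ L n, diam (connectedComponent x) < ε / 3 := by
      have := (Filter.eventually_all_finite (l := Filter.atTop)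
        (p := fun (C : Set X) (n : ℕ) => ∀ x ∈ L n, connectedComponent x ≠ C)
        (null (ε / 3) (by positivity))).2 ?_
      · filter_upwards [this] with n hn x hx
        by_contra! h
        exact hn _ ⟨⟨x, rfl⟩, h⟩ x hx rfl
      · rintro _ ⟨⟨y, rfl⟩, -⟩
        by_cases hyS : y ∈ S
        · refine Filter.Eventually.of_forall fun n x hx h => hLS n x hx ?_
          rw [hS, connectedComponent_eq hyS, ← h]
          exact mem_connectedComponent
        by_cases hyQ : y ∈ Q
        · obtain ⟨m, hm⟩ := hcov y hyQ hyS
          filter_upwards [Filter.eventually_gt_atTop m] with n hn x hx h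
          refine hm.2 (hPG hn ((hP n).connectedComponent_subset hx.1 ?_))
          rw [h]; exact mem_connectedComponent
        · refine Filter.Eventually.of_forall fun n x hx h => hyQ ?_
          refine hQ.connectedComponent_subset (hLQ n hx) ?_
          rw [h]; exact mem_connectedComponent
    have h1 := (tendsto_order.1 tendsto_one_div_add_atTop_nhds_zero_nat).2 (ε / 3)
      (show (0 : ℝ) < ε / 3 by positivity)
    obtain ⟨N, hN⟩ := Filter.eventually_atTop.1 (hev.and h1)
    refine Finite.subset ((Finset.range (N + 1)).finite_toSet.biUnion fun n _ => hfin n) ?_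
    rintro q ⟨hqQ, hbad⟩
    obtain ⟨n, hn⟩ := mem_iUnion.1 hqQ
    refine mem_biUnion (x := n) ?_ hn
    by_contra hnN
    have hnN : N < n := by simpa [Nat.lt_succ_iff] using hnN
    refine hbad ?_
    obtain ⟨-, ⟨y, hy⟩, x, hx, hd⟩ := hq n q hn
    obtain ⟨s, hs, hys⟩ := mem_thickening_iff.1 (hGt N (hPG hnN (hsub n q hn hy).1))
    refine ⟨s, hs, fun z hz => ?_⟩
    have e1 := (hN n hnN.le).1 x hx
    have e2 := (hN n hnN.le).2
    have e3 := (hN N le_rfl).2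
    have e4 := dist_le_diam_of_mem (hb q) hz hy
    have e5 := min_le_right δ (1 / (n + 1 : ℝ))
    rw [mem_ball]
    linarith [dist_triangle z y s]

variable [MetricSpace I]

/-- By `null` a positive diameter is exceeded by only finitely many components, so a maximum exists.
If all diameters vanish on `Q`, density supplies a copy. Maximality is what bounds the pieces cut
off afterwards. -/
theorem IsDecorated.exists_maximal_copy (h : IsDecorated I X) {Q : Set X} (hQ : IsClopen Q)
    (hne : Q.Nonempty) : ∃ x ∈ Q, IsCopyComponent I (connectedComponent x) ∧
      ∀ y ∈ Q, diam (connectedComponent y) ≤ diam (connectedComponent x) := by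
  by_cases hpos : ∃ y ∈ Q, 0 < diam (connectedComponent y)
  · obtain ⟨y, hy, hy0⟩ := hpos
    have hf : {S : Set X | (∃ x ∈ Q, S = connectedComponent x) ∧
        diam (connectedComponent y) ≤ diam S}.Finite :=
      (h.null _ hy0).subset fun S hS => ⟨let ⟨x, _, hx⟩ := hS.1; ⟨x, hx⟩, hS.2⟩
    obtain ⟨_, ⟨⟨x, hx, rfl⟩, hyx⟩, hmax⟩ := hf.exists_maximalFor diam _
      ⟨connectedComponent y, ⟨y, hy, rfl⟩, le_rfl⟩
    refine ⟨x, hx, (h.component x).resolve_left fun hs => ?_, fun z hz => ?_⟩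
    · rw [diam_subsingleton hs] at hyx; exact absurd hyx (not_le.2 hy0)
    · by_contra! hlt
      exact absurd (hmax (j := connectedComponent z) ⟨⟨z, hz, rfl⟩, hyx.trans hlt.le⟩ hlt.le)
        (not_le.2 hlt)
  · push Not at hpos
    obtain ⟨S, T, -, hS, -, hSQ, -⟩ := h.dense Q hQ.isOpen hne
    obtain ⟨⟨x, rfl⟩, hx⟩ := id hS
    exact ⟨x, hSQ mem_connectedComponent, hS, fun y hy => (hpos y hy).trans diam_nonneg⟩

/-- Each piece is attached to a nearest parameter on the copy. Density of copies makes these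
parameters accumulate everywhere, so the pieces can be renumbered to cluster along the given `τ`. -/
theorem IsDecorated.exists_decomposition [CompactSpace X] [CompactSpace I] [Nonempty I] (h : IsDecorated I X)
    {τ : ℕ → I} (hτ : ∀ s, ∀ ε > 0, {n | dist (τ n) s < ε}.Infinite)
    {Q : Set X} (hQ : IsClopen Q) (hne : Q.Nonempty) {δ : ℝ} (hδ : 0 < δ) :
    ∃ (γ : I → X) (q : ℕ → Set X), Continuous γ ∧ Function.Injective γ ∧
      (∃ x, range γ = connectedComponent x) ∧ (∀ k, IsClopen (q k) ∧ (q k).Nonempty) ∧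
      Q = range γ ∪ ⋃ k, q k ∧ (∀ k, Disjoint (range γ) (q k)) ∧
      (∀ k l, k ≠ l → Disjoint (q k) (q l)) ∧ (∀ k, diam (q k) ≤ diam (range γ) + δ) ∧
      ∀ ε > 0, ∀ᶠ k in Filter.atTop, q k ⊆ ball (γ (τ k)) ε := by
  obtain ⟨x₀, hx₀, ⟨-, γ, hγc, hγi, hγr⟩, hmax⟩ := h.exists_maximal_copy hQ hne
  obtain ⟨𝒬, hcount, hq, hdis, hun, hcl⟩ := exists_clopen_decomposition h.null hQ x₀ hδ hmax
  rw [← hγr] at hun hcl hq hmax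
  have hrQ : range γ ⊆ Q := hγr ▸ hQ.connectedComponent_subset hx₀
  have hqS : ∀ q ∈ 𝒬, Disjoint (range γ) q := fun q hqQ => disjoint_left.2 fun y hy hyq =>
    (hun.subset (mem_sUnion_of_mem hyq hqQ)).2 hy
  -- nearest points on the copy of `I`
  have hnear : ∀ q : 𝒬, ∃ t : I, ∃ z ∈ q.1, ∀ t', dist z (γ t) ≤ dist z (γ t') := fun q => by
    obtain ⟨z, hz⟩ := (hq q.1 q.2).2.1
    obtain ⟨t, -, ht⟩ := isCompact_univ.exists_isMinOn (univ_nonempty (α := I))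
      (f := fun t => dist z (γ t)) (by fun_prop)
    exact ⟨t, z, hz, fun t' => ht (mem_univ t')⟩
  choose t z hz htz using hnear
  have hclus : ∀ ε > 0, {q : 𝒬 | ¬ q.1 ⊆ ball (γ (t q)) ε}.Finite := fun ε hε => by
    refine (Finite.preimage (f := ((↑) : 𝒬 → Set X)) Subtype.val_injective.injOn
      (hcl (ε / 3) (by positivity))).subset fun q hqb => ?_
    refine ⟨q.2, fun ⟨s, ⟨t', ht'⟩, hs⟩ => hqb fun y hy => ?_⟩
    have e1 := hs hy
    have e2 := hs (hz q)
    have e3 := htz q t'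
    rw [ht'] at e3
    rw [mem_ball] at *
    linarith [dist_triangle y s (γ (t q)), dist_triangle s (z q) (γ (t q)), dist_comm s (z q)]
  have hacc : ∀ s : I, ∀ ε > 0, {q : 𝒬 | (q.1 ∩ ball (γ s) ε).Nonempty}.Infinite := by
    intro s ε hε hfin
    have hsQ : γ s ∈ Q := hrQ (mem_range_self s)
    -- If finitely many pieces met the ball, deleting them would leave a neighbourhood of `γ s` in
    -- which the only possible complete component is `range γ`; density provides two.
    obtain ⟨S, T, hST, ⟨⟨xS, hxS⟩, -⟩, ⟨⟨xT, hxT⟩, -⟩, hSU, hTU⟩ := h.dense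
      ((Q ∩ ball (γ s) ε) \ ⋃ q ∈ {q : 𝒬 | (q.1 ∩ ball (γ s) ε).Nonempty}, q.1)
      ((hQ.isOpen.inter isOpen_ball).sdiff (hfin.isClosed_biUnion fun q _ =>
        (hq q.1 q.2).1.isClosed)) ⟨γ s, ⟨hsQ, mem_ball_self hε⟩, fun hmem => by
          obtain ⟨q, -, hs⟩ := mem_iUnion₂.1 hmem
          exact disjoint_left.1 (hqS q.1 q.2) (mem_range_self s) hs⟩
    have key : ∀ C : Set X, (∃ x, C = connectedComponent x) →
        C ⊆ ((Q ∩ ball (γ s) ε) \ ⋃ q ∈ {q : 𝒬 | (q.1 ∩ ball (γ s) ε).Nonempty}, q.1) →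
        C = range γ := by
      rintro _ ⟨x, rfl⟩ hC
      have hx := hC mem_connectedComponent
      have hxr : x ∈ range γ := by
        by_contra hxr
        obtain ⟨q, hqQ, hxq⟩ := hun.superset ⟨hx.1.1, hxr⟩
        exact hx.2 (mem_biUnion (x := (⟨q, hqQ⟩ : 𝒬)) ⟨x, hxq, hx.1.2⟩ hxq)
      rw [hγr] at hxr ⊢
      exact (connectedComponent_eq hxr).symm
    exact hST ((key S ⟨xS, hxS⟩ hSU).trans (key T ⟨xT, hxT⟩ hTU).symm)
  have hemb := (hγc.isClosedEmbedding hγi).isEmbedding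
  have hinf : ∀ s, ∀ ε > 0, {q : 𝒬 | dist (t q) s < ε}.Infinite := fun s ε hε => by
    have : ball s ε ∈ (𝓝 (γ s)).comap γ := by
      rw [← hemb.nhds_eq_comap]; exact ball_mem_nhds s hε
    obtain ⟨V, hV, hVs⟩ := Filter.mem_comap.1 this
    obtain ⟨η, hη, hηV⟩ := Metric.mem_nhds_iff.1 hV
    refine ((hacc s (η / 2) (by positivity)).sdiff (hclus (η / 2) (by positivity))).mono ?_
    rintro q ⟨⟨y, hyq, hys⟩, hqb⟩
    have e := not_not.1 hqb hyq
    refine hVs (hηV ?_)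
    rw [mem_ball] at *
    linarith [dist_triangle_left (γ (t q)) (γ s) y]
  have : Infinite 𝒬 := by
    obtain ⟨s⟩ := ‹Nonempty I›
    exact infinite_univ_iff.1 ((hinf s 1 one_pos).mono (subset_univ _))
  have : Countable 𝒬 := hcount
  obtain ⟨e⟩ : Nonempty (ℕ ≃ 𝒬) := by
    have := Classical.choice (nonempty_denumerable 𝒬)
    exact ⟨(Denumerable.eqv 𝒬).symm⟩
  obtain ⟨b, hb, hbd⟩ := exists_bijective_dist_lt τ (fun n => t (e n)) hτ fun s ε hε => by
    have := (hinf s ε hε).preimage (f := e) (by rw [e.range_eq_univ]; exact subset_univ _)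
    exact this
  refine ⟨γ, fun k => (e (b k)).1, hγc, hγi, ⟨x₀, hγr⟩, fun k => ⟨(hq _ (e _).2).1,
    (hq _ (e _).2).2.1⟩, ?_, fun k => hqS _ (e _).2, fun k l hkl => ?_,
    fun k => (hq _ (e _).2).2.2, fun ε hε => ?_⟩
  · have : ⋃ k, (e (b k)).1 = ⋃₀ 𝒬 := by
      rw [sUnion_eq_iUnion]
      exact (hb.surjective.iUnion_comp (fun k => (e k).1)).trans
        (e.surjective.iUnion_comp (fun q : 𝒬 => q.1))
    rw [this, hun, union_sdiff_self, union_eq_self_of_subset_left hrQ]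
  · refine hdis (e _).2 (e _).2 fun heq => hkl (hb.injective (e.injective (Subtype.ext heq)))
  · have hu : UniformContinuous γ := CompactSpace.uniformContinuous_of_continuous hγc
    obtain ⟨η, hη, hηγ⟩ := Metric.uniformContinuous_iff.1 hu (ε / 2) (by positivity)
    have h1 : ∀ᶠ k in Filter.atTop, (e (b k)).1 ⊆ ball (γ (t (e (b k)))) (ε / 2) := by
      rw [← Nat.cofinite_eq_atTop]
      have := (hclus (ε / 2) (by positivity)).preimage
        ((e.injective.comp hb.injective).injOn (s := (e ∘ b) ⁻¹' _))
      exact this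
    filter_upwards [h1, hbd η hη] with k hk hk' y hy
    have e1 := hk hy
    have e2 := hηγ hk'
    rw [mem_ball] at *
    linarith [dist_triangle_right y (γ (τ k)) (γ (t (e (b k))))]

end Decompose

/-! ### Uniqueness of decorated spaces -/

section Universal

variable {I X Y : Type*} [MetricSpace I] [MetricSpace X] [MetricSpace Y] [CompactSpace I]
  [CompactSpace X] [CompactSpace Y] [Nonempty I] [Nonempty X] [Nonempty Y]

/-- The decomposition is iterated with tolerance `(1 / 2) ^ n` at depth `n`. Along a branch the
copies are distinct components, so their diameters tend to zero by `null`, and with them the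
diameters of the nodes. -/
theorem IsDecorated.nonempty_decorationTree (h : IsDecorated I X)
    {τ : ℕ → I} (hτ : ∀ s, ∀ ε > 0, {n | dist (τ n) s < ε}.Infinite) :
    Nonempty (DecorationTree I X τ) := by
  have hdec := fun (Q : {Q : Set X // IsClopen Q ∧ Q.Nonempty}) (n : ℕ) =>
    h.exists_decomposition hτ Q.2.1 Q.2.2 (δ := (1 / 2) ^ n) (by positivity)
  choose γ q hc hi hcomp hq hun hdr hdq hdiam hcl using hdec
  let N : List ℕ → {Q : Set X // IsClopen Q ∧ Q.Nonempty} := fun w =>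
    List.rec ⟨univ, isClopen_univ, univ_nonempty⟩ (fun k w Q => ⟨q Q w.length k, hq Q w.length k⟩) w
  refine ⟨{
    Q := fun w => (N w).1
    γ := fun w => γ (N w) w.length
    nil_eq := rfl
    isClopen := fun w => (N w).2.1
    nonempty := fun w => (N w).2.2
    continuous := fun w => hc _ _
    injective := fun w => hi _ _
    eq_union := fun w => hun _ _
    disjoint_range := fun w k => hdr _ _ k
    disjoint_child := fun w k l => hdq _ _ k l
    cluster := fun w => hcl _ _
    diam_lt := fun w h0 hs ε hε => ?_ }⟩
  have hlen : ∀ n, (w n).length = n := fun n => by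
    induction n with
    | zero => simp [h0]
    | succ n ih => obtain ⟨k, hk⟩ := hs n; simp [hk, ih]
  have hanti : Antitone fun n => (N (w n)).1 := antitone_nat_of_succ_le fun n => by
    obtain ⟨k, hk⟩ := hs n
    rw [hk]
    change q (N (w n)) _ k ⊆ (N (w n)).1
    conv_rhs => rw [hun (N (w n)) (w n).length]
    exact (subset_iUnion (q (N (w n)) (w n).length) k).trans subset_union_right
  have hrange : ∀ n, range (γ (N (w n)) n) ⊆ (N (w n)).1 := fun n => by
    conv_rhs => rw [hun (N (w n)) n]
    exact subset_union_left
  have hinj : Function.Injective fun n => range (γ (N (w n)) n) := by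
    have key : ∀ n m, n < m → range (γ (N (w n)) n) ≠ range (γ (N (w m)) m) := ?_
    · intro n m heq
      rcases lt_trichotomy n m with hnm | hnm | hnm
      exacts [absurd heq (key n m hnm), hnm, absurd heq.symm (key m n hnm)]
    intro n m hnm heq
    obtain ⟨k, hk⟩ := hs n
    obtain ⟨t⟩ := ‹Nonempty I›
    have h1 : γ (N (w m)) m t ∈ (N (w (n + 1))).1 :=
      hanti (Nat.succ_le_of_lt hnm) (hrange m (mem_range_self t))
    rw [hk] at h1
    have h2 := hdr (N (w n)) (w n).length k
    rw [hlen n] at h2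
    refine disjoint_left.1 h2 (heq.superset (mem_range_self t)) ?_
    have h3 : γ (N (w m)) m t ∈ q (N (w n)) (w n).length k := h1
    rwa [hlen n] at h3
  have hfin : {n | ε / 2 ≤ diam (range (γ (N (w n)) n))}.Finite :=
    ((h.null (ε / 2) (by positivity)).preimage hinj.injOn).subset fun n hn => ⟨hcomp _ _, hn⟩
  have h1 := (tendsto_order.1 (tendsto_pow_atTop_nhds_zero_of_lt_one (r := (1 / 2 : ℝ))
    (by norm_num) (by norm_num))).2 (ε / 2) (show (0 : ℝ) < ε / 2 by positivity)
  have h2 := hfin.compl_mem_cofinite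
  rw [Nat.cofinite_eq_atTop] at h2
  obtain ⟨n, hn1, hn2⟩ := (h1.and h2).exists
  refine ⟨n + 1, ?_⟩
  obtain ⟨k, hk⟩ := hs n
  have h3 := hdiam (N (w n)) (w n).length k
  have h4 : (N (w (n + 1))).1 = q (N (w n)) (w n).length k := by rw [hk]
  change diam (N (w (n + 1))).1 < ε
  rw [h4]
  rw [hlen n] at h3 ⊢
  have h5 : diam (range (γ (N (w n)) n)) < ε / 2 := not_le.1 hn2
  linarith

/-- Spaces decorated by copies of the same space are homeomorphic. -/
theorem IsDecorated.nonempty_homeomorph (hX : IsDecorated I X) (hY : IsDecorated I Y) :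
    Nonempty (X ≃ₜ Y) := by
  obtain ⟨τ, hτ⟩ := exists_accumulating_sequence I
  obtain ⟨T⟩ := hX.nonempty_decorationTree hτ
  obtain ⟨T'⟩ := hY.nonempty_decorationTree hτ
  exact T.nonempty_homeomorph T'

end Universal

/-- Perfect totally disconnected metric spaces are decorated by points. -/
theorem isDecorated_unit {X : Type*} [MetricSpace X] [TotallyDisconnectedSpace X]
    (h : ∀ U : Set X, IsOpen U → U.Nonempty → U.Nontrivial) : IsDecorated Unit X where
  component x := Or.inl (by
    rw [totallyDisconnectedSpace_iff_connectedComponent_singleton.1 inferInstance x]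
    exact subsingleton_singleton)
  null ε hε := by
    convert finite_empty
    refine eq_empty_of_forall_notMem ?_
    rintro _ ⟨⟨x, rfl⟩, hx⟩
    rw [totallyDisconnectedSpace_iff_connectedComponent_singleton.1 inferInstance x,
      diam_singleton] at hx
    linarith
  dense U hU hne := by
    obtain ⟨x, hx, y, hy, hxy⟩ := h U hU hne
    have key : ∀ z : X, IsCopyComponent Unit ({z} : Set X) := fun z =>
      ⟨⟨z, (totallyDisconnectedSpace_iff_connectedComponent_singleton.1 inferInstance z).symm⟩,
        fun _ => z, continuous_const, Function.injective_of_subsingleton _, range_const⟩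
    exact ⟨{x}, {y}, by simpa using hxy, key x, key y, by simpa using hx, by simpa using hy⟩

/-! ### Coordinates and basic properties of fractal squares -/

noncomputable section

/-- The point with coordinates `a`, `b`. -/
def planePoint (a b : ℝ) : Plane := !₂[a, b]

@[simp] theorem planePoint_zero (a b : ℝ) : planePoint a b 0 = a := rfl

@[simp] theorem planePoint_one (a b : ℝ) : planePoint a b 1 = b := rfl

theorem plane_ext {x y : Plane} (h0 : x 0 = y 0) (h1 : x 1 = y 1) : x = y := by
  ext i
  fin_cases i
  exacts [h0, h1]

theorem continuous_planePoint {X : Type*} [TopologicalSpace X] {f g : X → ℝ} (hf : Continuous f)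
    (hg : Continuous g) : Continuous fun x => planePoint (f x) (g x) := by
  refine (PiLp.continuous_toLp 2 _).comp (continuous_pi fun i => ?_)
  fin_cases i
  exacts [hf, hg]

theorem continuous_coordinate (i : Fin 2) : Continuous fun x : Plane => x i :=
  PiLp.continuous_apply 2 _ i

theorem dist_le_of_coordinates {x y : Plane} {ε : ℝ} (h0 : |x 0 - y 0| ≤ ε) (h1 : |x 1 - y 1| ≤ ε) :
    dist x y ≤ 2 * ε := by
  have hε : 0 ≤ ε := (abs_nonneg _).trans h0
  rw [EuclideanSpace.dist_eq, Fin.sum_univ_two, Real.dist_eq, Real.dist_eq]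
  refine Real.sqrt_le_iff.2 ⟨by positivity, ?_⟩
  nlinarith [abs_nonneg (x 0 - y 0), abs_nonneg (x 1 - y 1)]

@[simp] theorem digitMap_zero (d : Fin 3 × Fin 3) (x : Plane) :
    digitMap 3 d x 0 = (x 0 + (d.1 : ℕ)) / 3 := by
  simp [digitMap]; ring

@[simp] theorem digitMap_one (d : Fin 3 × Fin 3) (x : Plane) :
    digitMap 3 d x 1 = (x 1 + (d.2 : ℕ)) / 3 := by
  simp [digitMap]; ring

section Basic

variable {D : Finset (Fin 3 × Fin 3)}

theorem digitMap_mem (hD : D.Nonempty) {d : Fin 3 × Fin 3} (hd : d ∈ D) {x : Plane}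
    (hx : x ∈ fractalSquare 3 D) : digitMap 3 d x ∈ fractalSquare 3 D := by
  rw [(isFractalSquare_fractalSquare 3 (by norm_num) D hD).eq_iUnion]
  exact mem_biUnion hd (mem_image_of_mem _ hx)

theorem exists_digitMap_eq (hD : D.Nonempty) {x : Plane} (hx : x ∈ fractalSquare 3 D) :
    ∃ d ∈ D, ∃ y ∈ fractalSquare 3 D, digitMap 3 d y = x := by
  rw [(isFractalSquare_fractalSquare 3 (by norm_num) D hD).eq_iUnion] at hx
  simpa using hx

theorem isCompact_fractalSquare (hD : D.Nonempty) : IsCompact (fractalSquare 3 D) :=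
  (isFractalSquare_fractalSquare 3 (by norm_num) D hD).isCompact

theorem nonempty_fractalSquare (hD : D.Nonempty) : (fractalSquare 3 D).Nonempty :=
  (isFractalSquare_fractalSquare 3 (by norm_num) D hD).nonempty

theorem digitMap_apply (d : Fin 3 × Fin 3) (x : Plane) (i : Fin 2) :
    ∃ j : Fin 3, digitMap 3 d x i = (x i + (j : ℕ)) / 3 := by
  fin_cases i
  exacts [⟨d.1, digitMap_zero d x⟩, ⟨d.2, digitMap_one d x⟩]

/-- An extreme coordinate `m` satisfies `m = (y + j) / 3` with `y` another coordinate value and `0 ≤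
j ≤ 2`. Extremality forces `m ≥ 0` for the minimum and `m ≤ 1` for the maximum. -/
theorem coordinate_mem_Icc (hD : D.Nonempty) {x : Plane} (hx : x ∈ fractalSquare 3 D) (i : Fin 2) :
    x i ∈ Icc (0 : ℝ) 1 := by
  have hc := isCompact_fractalSquare hD
  have hne := nonempty_fractalSquare hD
  constructor
  · obtain ⟨m, hm, hmin⟩ := hc.exists_isMinOn hne (continuous_coordinate i).continuousOn
    obtain ⟨d, hd, y, hy, hyx⟩ := exists_digitMap_eq hD hm
    obtain ⟨j, hj⟩ := digitMap_apply d y i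
    have h1 : m i ≤ y i := hmin hy
    have h2 : m i ≤ x i := hmin hx
    rw [hyx] at hj
    have h3 : (0 : ℝ) ≤ (j : ℕ) := Nat.cast_nonneg _
    linarith
  · obtain ⟨m, hm, hmax⟩ := hc.exists_isMaxOn hne (continuous_coordinate i).continuousOn
    obtain ⟨d, hd, y, hy, hyx⟩ := exists_digitMap_eq hD hm
    obtain ⟨j, hj⟩ := digitMap_apply d y i
    have h1 : y i ≤ m i := hmax hy
    have h2 : x i ≤ m i := hmax hx
    rw [hyx] at hj
    have h3 : ((j : ℕ) : ℝ) ≤ 2 := by exact_mod_cast (by omega : (j : ℕ) ≤ 2)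
    linarith

/-- The fixed point of a digit map belongs to the fractal square. -/
theorem planePoint_half_mem (hD : D.Nonempty) {d : Fin 3 × Fin 3} (hd : d ∈ D) :
    planePoint ((d.1 : ℕ) / 2) ((d.2 : ℕ) / 2) ∈ fractalSquare 3 D := by
  set p := planePoint ((d.1 : ℕ) / 2) ((d.2 : ℕ) / 2) with hp
  have hfix : digitMap 3 d p = p := by
    refine plane_ext ?_ ?_ <;> simp [hp] <;> ring
  -- The digit map divides the distance to `p` by three, so the point of the fractal square nearest
  -- to `p` must be `p`.
  obtain ⟨m, hm, hmin⟩ := (isCompact_fractalSquare hD).exists_isMinOn (nonempty_fractalSquare hD)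
    (f := fun x => dist x p) (by fun_prop)
  have h1 : dist m p ≤ dist (digitMap 3 d m) p := hmin (digitMap_mem hD hd hm)
  have h2 := (lipschitzWith_digitMap 3 d).dist_le_mul m p
  rw [hfix] at h2
  push_cast at h2
  have h3 : dist m p = 0 := by
    have := dist_nonneg (x := m) (y := p)
    linarith
  rwa [← dist_eq_zero.1 h3]

end Basic

/-! ### Cells and their integer addresses -/

section Cells

/-- The integer vector of a digit. -/
def digitVec (d : Fin 3 × Fin 3) : ℤ × ℤ := ((d.1 : ℕ), (d.2 : ℕ))

/-- The address obtained from `p` by appending the digit `d`. -/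
def append (p d : ℤ × ℤ) : ℤ × ℤ := (3 * p.1 + d.1, 3 * p.2 + d.2)

/-- The integer positions of the cells of level `k`. -/
def addresses (D : Finset (Fin 3 × Fin 3)) : ℕ → Finset (ℤ × ℤ)
  | 0 => {(0, 0)}
  | k + 1 => (addresses D k ×ˢ D).image fun q => append q.1 (digitVec q.2)

/-- The map rescaling the cell of level `k` at `v` to full size. -/
def zoom (k : ℕ) (v : ℤ × ℤ) (x : Plane) : Plane :=
  planePoint (3 ^ k * x 0 - v.1) (3 ^ k * x 1 - v.2)

/-- The inverse of `zoom`. -/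
def unzoom (k : ℕ) (v : ℤ × ℤ) (x : Plane) : Plane :=
  planePoint ((x 0 + v.1) / 3 ^ k) ((x 1 + v.2) / 3 ^ k)

theorem zoom_unzoom (k : ℕ) (v : ℤ × ℤ) (x : Plane) : zoom k v (unzoom k v x) = x := by
  refine plane_ext ?_ ?_ <;> simp [zoom, unzoom] <;> field_simp <;> ring

theorem continuous_zoom (k : ℕ) (v : ℤ × ℤ) : Continuous (zoom k v) :=
  continuous_planePoint
    ((continuous_const.mul (continuous_coordinate 0)).sub continuous_const)
    ((continuous_const.mul (continuous_coordinate 1)).sub continuous_const)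

theorem digitMap_zoom_append (k : ℕ) (p : ℤ × ℤ) (d : Fin 3 × Fin 3) (x : Plane) :
    digitMap 3 d (zoom (k + 1) (append p (digitVec d)) x) = zoom k p x := by
  refine plane_ext ?_ ?_ <;> simp [zoom, append, digitVec] <;> ring

theorem zoom_append_of_digitMap_eq {k : ℕ} {p : ℤ × ℤ} {d : Fin 3 × Fin 3} {x y : Plane}
    (h : digitMap 3 d y = zoom k p x) : zoom (k + 1) (append p (digitVec d)) x = y := by
  have h0 := congrArg (fun z : Plane => z 0) h
  have h1 := congrArg (fun z : Plane => z 1) h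
  simp only [digitMap_zero, digitMap_one, zoom, planePoint_zero, planePoint_one] at h0 h1
  refine plane_ext ?_ ?_ <;> simp [zoom, append, digitVec, pow_succ] <;> linarith

variable {D : Finset (Fin 3 × Fin 3)}

theorem append_mem_addresses {k : ℕ} {p : ℤ × ℤ} (hp : p ∈ addresses D k) {d : Fin 3 × Fin 3}
    (hd : d ∈ D) : append p (digitVec d) ∈ addresses D (k + 1) :=
  Finset.mem_image_of_mem (fun q : (ℤ × ℤ) × (Fin 3 × Fin 3) => append q.1 (digitVec q.2))
    (Finset.mk_mem_product hp hd)

theorem exists_of_mem_addresses_succ {k : ℕ} {v : ℤ × ℤ} (hv : v ∈ addresses D (k + 1)) :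
    ∃ p ∈ addresses D k, ∃ d ∈ D, append p (digitVec d) = v := by
  obtain ⟨⟨p, d⟩, hq, h⟩ := Finset.mem_image.1 hv
  rw [Finset.mem_product] at hq
  exact ⟨p, hq.1, d, hq.2, h⟩

theorem zoom_mem_of_append (hD : D.Nonempty) {k : ℕ} {p : ℤ × ℤ} {d : Fin 3 × Fin 3} (hd : d ∈ D)
    {x : Plane} (h : zoom (k + 1) (append p (digitVec d)) x ∈ fractalSquare 3 D) :
    zoom k p x ∈ fractalSquare 3 D :=
  digitMap_zoom_append k p d x ▸ digitMap_mem hD hd h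

theorem exists_zoom_append_mem (hD : D.Nonempty) {k : ℕ} {p : ℤ × ℤ} {x : Plane}
    (h : zoom k p x ∈ fractalSquare 3 D) :
    ∃ d ∈ D, zoom (k + 1) (append p (digitVec d)) x ∈ fractalSquare 3 D := by
  obtain ⟨d, hd, y, hy, hyx⟩ := exists_digitMap_eq hD h
  exact ⟨d, hd, by rwa [zoom_append_of_digitMap_eq hyx]⟩

theorem zoom_zero (x : Plane) : zoom 0 (0, 0) x = x := by
  refine plane_ext ?_ ?_ <;> simp [zoom]

theorem exists_address (hD : D.Nonempty) {x : Plane} (hx : x ∈ fractalSquare 3 D) (k : ℕ) :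
    ∃ v ∈ addresses D k, zoom k v x ∈ fractalSquare 3 D := by
  induction k with
  | zero => exact ⟨(0, 0), by simp [addresses], by rwa [zoom_zero]⟩
  | succ k ih =>
    obtain ⟨p, hp, h⟩ := ih
    obtain ⟨d, hd, h'⟩ := exists_zoom_append_mem hD h
    exact ⟨_, append_mem_addresses hp hd, h'⟩

theorem mem_of_zoom_mem (hD : D.Nonempty) {x : Plane} {k : ℕ} {v : ℤ × ℤ}
    (hv : v ∈ addresses D k) (h : zoom k v x ∈ fractalSquare 3 D) : x ∈ fractalSquare 3 D := by
  induction k generalizing v with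
  | zero =>
    simp only [addresses, Finset.mem_singleton] at hv
    rwa [hv, zoom_zero] at h
  | succ k ih =>
    obtain ⟨p, hp, d, hd, rfl⟩ := exists_of_mem_addresses_succ hv
    exact ih hp (zoom_mem_of_append hD hd h)

theorem unzoom_mem (hD : D.Nonempty) {x : Plane} {k : ℕ} {v : ℤ × ℤ}
    (hv : v ∈ addresses D k) (h : x ∈ fractalSquare 3 D) : unzoom k v x ∈ fractalSquare 3 D :=
  mem_of_zoom_mem hD hv (by rwa [zoom_unzoom])

theorem dist_le_of_zoom_mem (hD : D.Nonempty) {x y : Plane} {k : ℕ} {v : ℤ × ℤ}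
    (hx : zoom k v x ∈ fractalSquare 3 D) (hy : zoom k v y ∈ fractalSquare 3 D) :
    dist x y ≤ 2 * (1 / 3) ^ k := by
  have key : ∀ a b c : ℝ, 3 ^ k * a - c ∈ Icc (0 : ℝ) 1 → 3 ^ k * b - c ∈ Icc (0 : ℝ) 1 →
      |a - b| ≤ (1 / 3) ^ k := by
    intro a b c ha hb
    rw [one_div, inv_pow, ← one_div, le_div_iff₀ (by positivity), mul_comm]
    rw [← abs_of_pos (show (0 : ℝ) < 3 ^ k by positivity), ← abs_mul, abs_le]
    constructor <;> nlinarith [ha.1, ha.2, hb.1, hb.2]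
  exact dist_le_of_coordinates (key _ _ _ (coordinate_mem_Icc hD hx 0) (coordinate_mem_Icc hD hy 0))
    (key _ _ _ (coordinate_mem_Icc hD hx 1) (coordinate_mem_Icc hD hy 1))

end Cells

end

/-! ### Certificates for the direction of components -/

section Labels

/-- Otherwise the pieces with the label of `i` and those with other labels would be two disjoint
closed sets separating `C`. -/
theorem IsPreconnected.label_eq {X ι J : Type*} [TopologicalSpace X] {s : Finset ι} {F : ι → Set X}
    (hF : ∀ i ∈ s, IsClosed (F i)) (l : ι → J)
    (hl : ∀ i ∈ s, ∀ j ∈ s, (F i ∩ F j).Nonempty → l i = l j) {C : Set X} (hC : IsPreconnected C)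
    (hCF : ∀ x ∈ C, ∃ i ∈ s, x ∈ F i) {i j : ι} (hi : i ∈ s) (hj : j ∈ s)
    (hCi : (C ∩ F i).Nonempty) (hCj : (C ∩ F j).Nonempty) : l i = l j := by
  by_contra hne
  have hcl : ∀ P : ι → Prop, IsClosed (⋃ k ∈ {k | k ∈ s ∧ P k}, F k) := fun P =>
    (s.finite_toSet.subset fun k hk => hk.1).isClosed_biUnion fun k hk => hF k hk.1
  have hcov : C ⊆ (⋃ k ∈ {k | k ∈ s ∧ l k = l i}, F k) ∪ ⋃ k ∈ {k | k ∈ s ∧ l k ≠ l i}, F k := by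
    intro x hx
    obtain ⟨k, hk, hxk⟩ := hCF x hx
    by_cases h : l k = l i
    · exact Or.inl (mem_biUnion (x := k) ⟨hk, h⟩ hxk)
    · exact Or.inr (mem_biUnion (x := k) ⟨hk, h⟩ hxk)
  obtain ⟨y, hyC, hyi⟩ := hCi
  obtain ⟨z, hzC, hzj⟩ := hCj
  obtain ⟨x, -, hx, hx'⟩ := isPreconnected_closed_iff.1 hC _ _ (hcl _) (hcl _) hcov
    ⟨y, hyC, mem_biUnion (x := i) ⟨hi, rfl⟩ hyi⟩
    ⟨z, hzC, mem_biUnion (x := j) ⟨hj, Ne.symm hne⟩ hzj⟩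
  obtain ⟨a, ⟨ha, hla⟩, hxa⟩ := mem_iUnion₂.1 hx
  obtain ⟨b, ⟨hb, hlb⟩, hxb⟩ := mem_iUnion₂.1 hx'
  exact hlb ((hl b hb a ha ⟨x, hxb, hxa⟩).trans hla)

/-- The relative position of two subcells of cells in relative position `s`. -/
def carry (s d e : ℤ × ℤ) : ℤ × ℤ := (3 * s.1 + e.1 - d.1, 3 * s.2 + e.2 - d.2)

/-- A necessary condition for a fractal square to meet its translate by `t`. -/
def mayMeet (L : List (ℤ × ℤ)) : ℕ → ℤ × ℤ → Bool
  | 0, t => decide (t.1 ≤ 1) && decide (-1 ≤ t.1) && decide (t.2 ≤ 1) && decide (-1 ≤ t.2)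
  | n + 1, t => (decide (t.1 ≤ 1) && decide (-1 ≤ t.1) && decide (t.2 ≤ 1) && decide (-1 ≤ t.2)) &&
      L.any fun d => L.any fun e => mayMeet L n (carry t d e)

/-- `S` contains the relative positions of all pairs of touching cells of equal size. -/
def closedCarries (L S : List (ℤ × ℤ)) : Bool :=
  S.contains (0, 0) && S.all fun s => L.all fun d => L.all fun e =>
    -- A relative position outside `S` has to be refuted within three further subdivisions.
    S.contains (carry s d e) || !mayMeet L 3 (carry s d e)

/-- Correcting the linear form `φ` by a function `c` of the last three digits gives equal values
on touching cells. -/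
def labelsAgree (L S : List (ℤ × ℤ)) (φ : ℤ × ℤ) (c : ℤ × ℤ → ℤ × ℤ → ℤ × ℤ → ℤ) : Bool :=
  S.all fun s =>
    L.all fun d₁ => L.all fun e₁ => !S.contains (carry s d₁ e₁) ||
    L.all fun d₂ => L.all fun e₂ => !S.contains (carry (carry s d₁ e₁) d₂ e₂) ||
    L.all fun d₃ => L.all fun e₃ => !S.contains (carry (carry (carry s d₁ e₁) d₂ e₂) d₃ e₃) ||
      decide (φ.1 * (carry (carry (carry s d₁ e₁) d₂ e₂) d₃ e₃).1 +
        φ.2 * (carry (carry (carry s d₁ e₁) d₂ e₂) d₃ e₃).2 + c e₁ e₂ e₃ = c d₁ d₂ d₃)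

variable {D : Finset (Fin 3 × Fin 3)} {L S : List (ℤ × ℤ)}

/-- Both squares lie in the unit square, which bounds `t`; passing to subcells containing the two
points replaces `t` by a carry. -/
theorem mayMeet_of_mem (hD : D.Nonempty) (hL : ∀ d ∈ D, digitVec d ∈ L) (n : ℕ) {t : ℤ × ℤ}
    {x y : Plane} (hx : x ∈ fractalSquare 3 D) (hy : y ∈ fractalSquare 3 D)
    (h0 : x 0 - y 0 = t.1) (h1 : x 1 - y 1 = t.2) : mayMeet L n t = true := by
  have hb : (decide (t.1 ≤ 1) && decide (-1 ≤ t.1) && decide (t.2 ≤ 1) && decide (-1 ≤ t.2)) =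
      true := by
    have hx0 := coordinate_mem_Icc hD hx 0
    have hx1 := coordinate_mem_Icc hD hx 1
    have hy0 := coordinate_mem_Icc hD hy 0
    have hy1 := coordinate_mem_Icc hD hy 1
    simp only [Bool.and_eq_true, decide_eq_true_eq]
    refine ⟨⟨⟨?_, ?_⟩, ?_⟩, ?_⟩
    · exact_mod_cast (show (t.1 : ℝ) ≤ 1 by linarith [hx0.2, hy0.1])
    · exact_mod_cast (show (-1 : ℝ) ≤ t.1 by linarith [hx0.1, hy0.2])
    · exact_mod_cast (show (t.2 : ℝ) ≤ 1 by linarith [hx1.2, hy1.1])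
    · exact_mod_cast (show (-1 : ℝ) ≤ t.2 by linarith [hx1.1, hy1.2])
  induction n generalizing t x y with
  | zero => exact hb
  | succ n ih =>
    obtain ⟨d, hd, x', hx', rfl⟩ := exists_digitMap_eq hD hx
    obtain ⟨e, he, y', hy', rfl⟩ := exists_digitMap_eq hD hy
    simp only [digitMap_zero, digitMap_one] at h0 h1
    rw [mayMeet, hb, Bool.true_and, List.any_eq_true]
    refine ⟨_, hL d hd, List.any_eq_true.2 ⟨_, hL e he, ?_⟩⟩
    have e0 : x' 0 - y' 0 = (carry t (digitVec d) (digitVec e)).1 := by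
      simp only [carry, digitVec]; push_cast; linarith
    have e1 : x' 1 - y' 1 = (carry t (digitVec d) (digitVec e)).2 := by
      simp only [carry, digitVec]; push_cast; linarith
    refine ih hx' hy' e0 e1 ?_
    have hx0 := coordinate_mem_Icc hD hx' 0
    have hx1 := coordinate_mem_Icc hD hx' 1
    have hy0 := coordinate_mem_Icc hD hy' 0
    have hy1 := coordinate_mem_Icc hD hy' 1
    simp only [Bool.and_eq_true, decide_eq_true_eq]
    refine ⟨⟨⟨?_, ?_⟩, ?_⟩, ?_⟩
    · exact_mod_cast (show ((carry t (digitVec d) (digitVec e)).1 : ℝ) ≤ 1 by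
        linarith [hx0.2, hy0.1])
    · exact_mod_cast (show (-1 : ℝ) ≤ (carry t (digitVec d) (digitVec e)).1 by
        linarith [hx0.1, hy0.2])
    · exact_mod_cast (show ((carry t (digitVec d) (digitVec e)).2 : ℝ) ≤ 1 by
        linarith [hx1.2, hy1.1])
    · exact_mod_cast (show (-1 : ℝ) ≤ (carry t (digitVec d) (digitVec e)).2 by
        linarith [hx1.1, hy1.2])

theorem carry_append (p q d e : ℤ × ℤ) :
    carry (q.1 - p.1, q.2 - p.2) d e =
      ((append q e).1 - (append p d).1, (append q e).2 - (append p d).2) := by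
  simp only [carry, append, Prod.mk.injEq]
  constructor <;> ring

theorem carry_mem_of_zoom_mem (hD : D.Nonempty) (hL : ∀ d ∈ D, digitVec d ∈ L)
    (hS : closedCarries L S = true) {k : ℕ} {p q d e : ℤ × ℤ} (hpq : (q.1 - p.1, q.2 - p.2) ∈ S)
    (hd : d ∈ L) (he : e ∈ L) {x : Plane} (hx : zoom k (append p d) x ∈ fractalSquare 3 D)
    (hy : zoom k (append q e) x ∈ fractalSquare 3 D) :
    carry (q.1 - p.1, q.2 - p.2) d e ∈ S := by
  simp only [closedCarries, Bool.and_eq_true, List.all_eq_true, Bool.or_eq_true,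
    List.contains_iff_mem, Bool.not_eq_true'] at hS
  refine (hS.2 _ hpq d hd e he).resolve_right ?_
  rw [carry_append, mayMeet_of_mem hD hL 3 hx hy]
  · simp
  · simp [zoom]
  · simp [zoom]

/-- Ancestors of touching cells touch, so relative positions follow carries from `(0, 0)` and never
leave `S`. -/
theorem sub_mem_of_zoom_mem (hD : D.Nonempty) (hL : ∀ d ∈ D, digitVec d ∈ L)
    (hS : closedCarries L S = true) {k : ℕ} {p q : ℤ × ℤ} (hp : p ∈ addresses D k)
    (hq : q ∈ addresses D k) {x : Plane} (hx : zoom k p x ∈ fractalSquare 3 D)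
    (hy : zoom k q x ∈ fractalSquare 3 D) : (q.1 - p.1, q.2 - p.2) ∈ S := by
  induction k generalizing p q with
  | zero =>
    simp only [addresses, Finset.mem_singleton] at hp hq
    simp only [closedCarries, Bool.and_eq_true, List.contains_iff_mem] at hS
    subst hp hq
    simpa using hS.1
  | succ k ih =>
    obtain ⟨p', hp', d, hd, rfl⟩ := exists_of_mem_addresses_succ hp
    obtain ⟨q', hq', e, he, rfl⟩ := exists_of_mem_addresses_succ hq
    have := ih hp' hq' (zoom_mem_of_append hD hd hx) (zoom_mem_of_append hD he hy)
    have := carry_mem_of_zoom_mem hD hL hS this (hL d hd) (hL e he) hx hy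
    rwa [carry_append] at this

/-- A certificate checked by `closedCarries` and `labelsAgree` shows that the linear form `φ` is
constant on the connected subsets of the fractal square. -/
theorem linear_eq_of_isPreconnected (hD : D.Nonempty) (hL : ∀ d ∈ D, digitVec d ∈ L)
    (hS : closedCarries L S = true) {φ : ℤ × ℤ} {c : ℤ × ℤ → ℤ × ℤ → ℤ × ℤ → ℤ}
    (hc : labelsAgree L S φ c = true) {C : Set Plane} (hC : IsPreconnected C)
    (hCK : C ⊆ fractalSquare 3 D) {x y : Plane} (hx : x ∈ C) (hy : y ∈ C) :
    φ.1 * x 0 + φ.2 * x 1 = φ.1 * y 0 + φ.2 * y 1 := by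
  let ι := (ℤ × ℤ) × (Fin 3 × Fin 3) × (Fin 3 × Fin 3) × (Fin 3 × Fin 3)
  let addr : ι → ℤ × ℤ := fun i =>
    append (append (append i.1 (digitVec i.2.1)) (digitVec i.2.2.1)) (digitVec i.2.2.2)
  let cor : ι → ℤ := fun i => c (digitVec i.2.1) (digitVec i.2.2.1) (digitVec i.2.2.2)
  let l : ι → ℤ := fun i => φ.1 * (addr i).1 + φ.2 * (addr i).2 + cor i
  obtain ⟨B, hB⟩ : ∃ B : ℝ, ∀ i : ι, |(cor i : ℝ)| ≤ B := by
    obtain ⟨B, hB⟩ := (finite_range fun d : (Fin 3 × Fin 3) × (Fin 3 × Fin 3) × (Fin 3 × Fin 3) =>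
      |((c (digitVec d.1) (digitVec d.2.1) (digitVec d.2.2) : ℤ) : ℝ)|).bddAbove
    exact ⟨B, fun i => hB ⟨i.2, rfl⟩⟩
  set a := φ.1 * x 0 + φ.2 * x 1 with ha
  set b := φ.1 * y 0 + φ.2 * y 1 with hb
  set M : ℝ := 2 * (|(φ.1 : ℝ)| + |(φ.2 : ℝ)| + B) with hM
  -- At level `k + 3` the label of a cell differs from the rescaled form by at most `M / 2`. Equal
  -- labels along `C` thus bound the rescaled difference by `M` for all `k`, forcing the difference
  -- to vanish.
  have key : ∀ k : ℕ, 3 ^ (k + 3) * |a - b| ≤ M := by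
    intro k
    let s : Finset ι := addresses D k ×ˢ D ×ˢ D ×ˢ D
    let F : ι → Set Plane := fun i => {z | zoom (k + 3) (addr i) z ∈ fractalSquare 3 D}
    have hF : ∀ i ∈ s, IsClosed (F i) := fun i _ =>
      (isCompact_fractalSquare hD).isClosed.preimage (continuous_zoom _ _)
    have hcov : ∀ z ∈ fractalSquare 3 D, ∃ i ∈ s, z ∈ F i := by
      intro z hz
      obtain ⟨p, hp, h0⟩ := exists_address hD hz k
      obtain ⟨d₁, h₁, h1⟩ := exists_zoom_append_mem hD h0
      obtain ⟨d₂, h₂, h2⟩ := exists_zoom_append_mem hD h1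
      obtain ⟨d₃, h₃, h3⟩ := exists_zoom_append_mem hD h2
      exact ⟨(p, d₁, d₂, d₃), Finset.mk_mem_product hp (Finset.mk_mem_product h₁
        (Finset.mk_mem_product h₂ h₃)), h3⟩
    have hl : ∀ i ∈ s, ∀ j ∈ s, (F i ∩ F j).Nonempty → l i = l j := by
      rintro ⟨p, d₁, d₂, d₃⟩ hi ⟨q, e₁, e₂, e₃⟩ hj ⟨z, hzi, hzj⟩
      obtain ⟨hp, hi⟩ := Finset.mem_product.1 hi
      obtain ⟨hd₁, hi⟩ := Finset.mem_product.1 hi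
      obtain ⟨hd₂, hd₃⟩ := Finset.mem_product.1 hi
      obtain ⟨hq, hj⟩ := Finset.mem_product.1 hj
      obtain ⟨he₁, hj⟩ := Finset.mem_product.1 hj
      obtain ⟨he₂, he₃⟩ := Finset.mem_product.1 hj
      change zoom (k + 3) (append (append (append p _) _) _) z ∈ fractalSquare 3 D at hzi
      change zoom (k + 3) (append (append (append q _) _) _) z ∈ fractalSquare 3 D at hzj
      have i2 := zoom_mem_of_append hD hd₃ hzi
      have j2 := zoom_mem_of_append hD he₃ hzj
      have i1 := zoom_mem_of_append hD hd₂ i2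
      have j1 := zoom_mem_of_append hD he₂ j2
      have i0 := zoom_mem_of_append hD hd₁ i1
      have j0 := zoom_mem_of_append hD he₁ j1
      have s0 := sub_mem_of_zoom_mem hD hL hS hp hq i0 j0
      have s1 := carry_mem_of_zoom_mem hD hL hS s0 (hL _ hd₁) (hL _ he₁) i1 j1
      have s2 := carry_mem_of_zoom_mem hD hL hS (carry_append p q _ _ ▸ s1) (hL _ hd₂) (hL _ he₂)
        i2 j2
      have s3 := carry_mem_of_zoom_mem hD hL hS (carry_append (append p _) (append q _) _ _ ▸ s2)
        (hL _ hd₃) (hL _ he₃) hzi hzj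
      rw [← carry_append (append p _) (append q _), ← carry_append p q] at s3
      rw [← carry_append p q] at s2
      simp only [labelsAgree, List.all_eq_true, Bool.or_eq_true, Bool.not_eq_true',
        List.contains_eq_mem, decide_eq_false_iff_not, decide_eq_true_eq] at hc
      have h1 := (hc _ s0 _ (hL _ hd₁) _ (hL _ he₁)).resolve_left (not_not.2 s1)
      have h2 := (h1 _ (hL _ hd₂) _ (hL _ he₂)).resolve_left (not_not.2 s2)
      have h3 := (h2 _ (hL _ hd₃) _ (hL _ he₃)).resolve_left (not_not.2 s3)
      rw [carry_append, carry_append, carry_append] at h3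
      simp only [l, addr, cor]
      simp only at h3
      linarith
    obtain ⟨i, hi, hxi⟩ := hcov x (hCK hx)
    obtain ⟨j, hj, hyj⟩ := hcov y (hCK hy)
    have hij := hC.label_eq hF l hl (fun z hz => hcov z (hCK hz)) hi hj ⟨x, hx, hxi⟩ ⟨y, hy, hyj⟩
    have est : ∀ (i : ι) (z : Plane), z ∈ F i →
        |3 ^ (k + 3) * (φ.1 * z 0 + φ.2 * z 1) - l i| ≤ M / 2 := by
      intro i z hz
      have h0 := coordinate_mem_Icc hD hz 0
      have h1 := coordinate_mem_Icc hD hz 1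
      simp only [zoom, planePoint_zero, planePoint_one] at h0 h1
      have e : 3 ^ (k + 3) * (φ.1 * z 0 + φ.2 * z 1) - l i =
          φ.1 * (3 ^ (k + 3) * z 0 - (addr i).1) + φ.2 * (3 ^ (k + 3) * z 1 - (addr i).2) -
            cor i := by
        simp only [l]; push_cast; ring
      rw [e]
      have b0 : |(φ.1 : ℝ) * (3 ^ (k + 3) * z 0 - (addr i).1)| ≤ |(φ.1 : ℝ)| := by
        rw [abs_mul, abs_of_nonneg h0.1]
        exact mul_le_of_le_one_right (abs_nonneg _) h0.2
      have b1 : |(φ.2 : ℝ) * (3 ^ (k + 3) * z 1 - (addr i).2)| ≤ |(φ.2 : ℝ)| := by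
        rw [abs_mul, abs_of_nonneg h1.1]
        exact mul_le_of_le_one_right (abs_nonneg _) h1.2
      have b2 := hB i
      rw [hM, abs_le]
      rw [abs_le] at b0 b1 b2
      constructor <;> linarith [b0.1, b0.2, b1.1, b1.2, b2.1, b2.2]
    have ex := est i x hxi
    have ey := est j y hyj
    rw [← hij, ← hb] at ey
    rw [← ha] at ex
    rw [← abs_of_pos (show (0 : ℝ) < 3 ^ (k + 3) by positivity), ← abs_mul, mul_sub]
    rw [abs_le] at ex ey ⊢
    constructor <;> linarith [ex.1, ex.2, ey.1, ey.2]
  by_contra hne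
  have hpos : 0 < |a - b| := abs_pos.2 (sub_ne_zero.2 hne)
  obtain ⟨n, hn⟩ := pow_unbounded_of_one_lt (M / |a - b|) (show (1 : ℝ) < 3 by norm_num)
  rw [div_lt_iff₀ hpos] at hn
  have h1 := key n
  have h2 : (3 : ℝ) ^ n ≤ 3 ^ (n + 3) := pow_le_pow_right₀ (by norm_num) (by omega)
  nlinarith

end Labels

/-! ### Horizontal lines inside a fractal square -/

section FullRow

variable {D : Finset (Fin 3 × Fin 3)} {r : Fin 3}

theorem exists_row_of_mem_column (hD : D.Nonempty) {i : Fin 3} {u y : ℝ} (hu : u ∈ Ioo (0 : ℝ) 1)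
    (h : planePoint ((u + (i : ℕ)) / 3) y ∈ fractalSquare 3 D) :
    ∃ j : Fin 3, (i, j) ∈ D ∧ planePoint u (3 * y - (j : ℕ)) ∈ fractalSquare 3 D := by
  obtain ⟨⟨a, j⟩, hd, z, hz, hzx⟩ := exists_digitMap_eq hD h
  have h0 := congrArg (fun w : Plane => w 0) hzx
  have h1 := congrArg (fun w : Plane => w 1) hzx
  simp only [digitMap_zero, digitMap_one, planePoint_zero, planePoint_one] at h0 h1
  have hb := coordinate_mem_Icc hD hz 0
  have hai : a = i := by
    have e1 : ((a : ℕ) : ℝ) < (i : ℕ) + 1 := by linarith [hu.2, hb.1]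
    have e2 : ((i : ℕ) : ℝ) < (a : ℕ) + 1 := by linarith [hu.1, hb.2]
    have e3 : (a : ℕ) < (i : ℕ) + 1 := by exact_mod_cast e1
    have e4 : (i : ℕ) < (a : ℕ) + 1 := by exact_mod_cast e2
    exact Fin.ext (by omega)
  subst hai
  refine ⟨j, hd, ?_⟩
  convert hz using 1
  refine plane_ext ?_ ?_
  · rw [planePoint_zero]; linarith
  · rw [planePoint_one]; linarith

theorem sub_mem_Icc_of_mem (hD : D.Nonempty) {u y : ℝ} (h : planePoint u y ∈ fractalSquare 3 D) :
    y ∈ Icc (0 : ℝ) 1 :=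
  coordinate_mem_Icc hD h 1

theorem column_mem_Ioo (i : Fin 3) {u : ℝ} (hu : u ∈ Ioo (0 : ℝ) 1) :
    (u + (i : ℕ)) / 3 ∈ Ioo (0 : ℝ) 1 := by
  have h1 : (0 : ℝ) ≤ (i : ℕ) := Nat.cast_nonneg _
  have h2 : ((i : ℕ) : ℝ) ≤ 2 := by exact_mod_cast (by omega : (i : ℕ) ≤ 2)
  constructor <;> linarith [hu.1, hu.2]

theorem half_mem_Ioo : (1 / 2 : ℝ) ∈ Ioo (0 : ℝ) 1 := by constructor <;> norm_num

/-- The bottom edge can only be covered by digits of row zero, in every column; so row zero is full.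
-/
theorem row_eq_zero_of_line_subset (hD : D.Nonempty) (hr : ∀ j ≠ r, ∃ i, (i, j) ∉ D)
    (h : ∀ u ∈ Ioo (0 : ℝ) 1, planePoint u 0 ∈ fractalSquare 3 D) : r = 0 := by
  by_contra hne
  obtain ⟨i, hi⟩ := hr 0 (Ne.symm hne)
  obtain ⟨j, hj, hm⟩ := exists_row_of_mem_column hD half_mem_Ioo (h _ (column_mem_Ioo i half_mem_Ioo))
  have h1 := (sub_mem_Icc_of_mem hD hm).1
  have h2 : ((j : ℕ) : ℝ) < 1 := by linarith
  have h3 : (j : ℕ) < 1 := by exact_mod_cast h2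
  have h4 : j = 0 := Fin.ext (by simpa using h3)
  exact hi (h4 ▸ hj)

theorem row_eq_two_of_line_subset (hD : D.Nonempty) (hr : ∀ j ≠ r, ∃ i, (i, j) ∉ D)
    (h : ∀ u ∈ Ioo (0 : ℝ) 1, planePoint u 1 ∈ fractalSquare 3 D) : r = 2 := by
  by_contra hne
  obtain ⟨i, hi⟩ := hr 2 (Ne.symm hne)
  obtain ⟨j, hj, hm⟩ := exists_row_of_mem_column hD half_mem_Ioo (h _ (column_mem_Ioo i half_mem_Ioo))
  have h1 := (sub_mem_Icc_of_mem hD hm).2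
  have h2 : (1 : ℝ) < (j : ℕ) := by linarith
  have h3 : 1 < (j : ℕ) := by exact_mod_cast h2
  have h4 : j = 2 := Fin.ext (by simp only [Fin.val_two]; omega)
  exact hi (h4 ▸ hj)

/-- A height meets at most two of the three closed rows. -/
theorem eq_of_three_mul_sub_mem {a b c : Fin 3} {y : ℝ} (ha : 3 * y - (a : ℕ) ∈ Icc (0 : ℝ) 1)
    (hb : 3 * y - (b : ℕ) ∈ Icc (0 : ℝ) 1) (hc : 3 * y - (c : ℕ) ∈ Icc (0 : ℝ) 1) (hab : a ≠ b)
    (hac : a ≠ c) : b = c := by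
  have key : ∀ {p q : Fin 3}, 3 * y - (p : ℕ) ∈ Icc (0 : ℝ) 1 → 3 * y - (q : ℕ) ∈ Icc (0 : ℝ) 1 →
      (p : ℕ) ≤ q + 1 := fun {p q} hp hq => by
    have : ((p : ℕ) : ℝ) ≤ (q : ℕ) + 1 := by linarith [hp.1, hq.2]
    exact_mod_cast this
  have h1 := key ha hb
  have h2 := key hb ha
  have h3 := key ha hc
  have h4 := key hc ha
  have h5 := key hb hc
  have h6 := key hc hb
  have h7 : (a : ℕ) ≠ b := fun h => hab (Fin.ext h)
  have h8 : (a : ℕ) ≠ c := fun h => hac (Fin.ext h)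
  exact Fin.ext (by omega)

/-- In a column where row `j` has no digit, the line runs through another row at the same height.
Only one such row is available, so the same `k` serves all `u`. -/
theorem exists_other_row (hD : D.Nonempty) (hr : ∀ j ≠ r, ∃ i, (i, j) ∉ D) {y : ℝ}
    (h : ∀ u ∈ Ioo (0 : ℝ) 1, planePoint u y ∈ fractalSquare 3 D) {j : Fin 3} (hj : j ≠ r)
    (hjy : 3 * y - (j : ℕ) ∈ Icc (0 : ℝ) 1) :
    ∃ k : Fin 3, k ≠ j ∧ ∀ u ∈ Ioo (0 : ℝ) 1, planePoint u (3 * y - (k : ℕ)) ∈ fractalSquare 3 D := by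
  obtain ⟨i, hi⟩ := hr j hj
  have key : ∀ u ∈ Ioo (0 : ℝ) 1, ∃ k : Fin 3, j ≠ k ∧
      planePoint u (3 * y - (k : ℕ)) ∈ fractalSquare 3 D := fun u hu => by
    obtain ⟨k, hk, hm⟩ := exists_row_of_mem_column hD hu (h _ (column_mem_Ioo i hu))
    exact ⟨k, fun e => hi (e ▸ hk), hm⟩
  obtain ⟨k, hk, hkm⟩ := key _ half_mem_Ioo
  refine ⟨k, hk.symm, fun u hu => ?_⟩
  obtain ⟨l, hl, hlm⟩ := key u hu
  rwa [eq_of_three_mul_sub_mem hjy (sub_mem_Icc_of_mem hD hkm) (sub_mem_Icc_of_mem hD hlm) hk hl]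

/-- If row `r` failed, two non-full rows would both carry the whole line, so it would be their
common border. One rescaled line is then a top edge and the other a bottom edge, which requires both
`r = 2` and `r = 0`. -/
theorem line_subset_step (hD : D.Nonempty) (hr : ∀ j ≠ r, ∃ i, (i, j) ∉ D) {y : ℝ}
    (h : ∀ u ∈ Ioo (0 : ℝ) 1, planePoint u y ∈ fractalSquare 3 D) :
    ∀ u ∈ Ioo (0 : ℝ) 1, planePoint u (3 * y - (r : ℕ)) ∈ fractalSquare 3 D := by
  by_contra! hcon
  obtain ⟨u, hu, hnot⟩ := hcon
  obtain ⟨a, -, ham⟩ := exists_row_of_mem_column hD hu (h _ (column_mem_Ioo 0 hu))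
  have har : a ≠ r := by rintro rfl; exact hnot ham
  have hay := sub_mem_Icc_of_mem hD ham
  obtain ⟨b, hba, hb⟩ := exists_other_row hD hr h har hay
  have hbr : b ≠ r := by rintro rfl; exact hnot (hb u hu)
  have hby := sub_mem_Icc_of_mem hD (hb u hu)
  obtain ⟨c, hcb, hc⟩ := exists_other_row hD hr h hbr hby
  have hca : a = c := eq_of_three_mul_sub_mem hby hay (sub_mem_Icc_of_mem hD (hc u hu)) hba hcb.symm
  subst hca
  have key : ∀ {p q : Fin 3}, p ≠ q →
      (∀ u ∈ Ioo (0 : ℝ) 1, planePoint u (3 * y - (p : ℕ)) ∈ fractalSquare 3 D) →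
      (∀ u ∈ Ioo (0 : ℝ) 1, planePoint u (3 * y - (q : ℕ)) ∈ fractalSquare 3 D) →
      3 * y - (p : ℕ) ∈ Icc (0 : ℝ) 1 → 3 * y - (q : ℕ) ∈ Icc (0 : ℝ) 1 → (p : ℕ) < q → False := by
    intro p q hpq hp hq hpy hqy hlt
    have e : ((p : ℕ) : ℝ) + 1 ≤ (q : ℕ) := by exact_mod_cast hlt
    have e1 : 3 * y - (p : ℕ) = 1 := by linarith [hpy.2, hqy.1]
    have e2 : 3 * y - (q : ℕ) = 0 := by linarith [hpy.2, hqy.1]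
    rw [e1] at hp
    rw [e2] at hq
    have := (row_eq_zero_of_line_subset hD hr hq).symm.trans (row_eq_two_of_line_subset hD hr hp)
    exact absurd this (by decide)
  rcases lt_or_gt_of_ne (fun e => hba (Fin.ext e) : (b : ℕ) ≠ a) with hlt | hlt
  · exact key hba hb hc hby hay hlt
  · exact key hba.symm hc hb hay hby hlt

/-- The map `y ↦ 3 * y - r` preserves heights of full lines and expands around its fixed point `r /
2`; bounded orbits allow only that point. -/
theorem eq_half_of_line_subset (hD : D.Nonempty) (hr : ∀ j ≠ r, ∃ i, (i, j) ∉ D) {y : ℝ}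
    (h : ∀ u ∈ Ioo (0 : ℝ) 1, planePoint u y ∈ fractalSquare 3 D) : y = (r : ℕ) / 2 := by
  have key : ∀ n : ℕ, ∀ u ∈ Ioo (0 : ℝ) 1,
      planePoint u ((r : ℕ) / 2 + 3 ^ n * (y - (r : ℕ) / 2)) ∈ fractalSquare 3 D := by
    intro n
    induction n with
    | zero => simpa using h
    | succ n ih =>
      convert line_subset_step hD hr ih using 5
      ring
  by_contra hne
  have hpos : 0 < |y - (r : ℕ) / 2| := abs_pos.2 (sub_ne_zero.2 hne)
  obtain ⟨n, hn⟩ := pow_unbounded_of_one_lt (1 / |y - (r : ℕ) / 2|) (show (1 : ℝ) < 3 by norm_num)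
  rw [div_lt_iff₀ hpos] at hn
  have hb := sub_mem_Icc_of_mem hD (key n _ half_mem_Ioo)
  have h1 : (0 : ℝ) ≤ (r : ℕ) := Nat.cast_nonneg _
  have h2 : ((r : ℕ) : ℝ) ≤ 2 := by exact_mod_cast (by omega : (r : ℕ) ≤ 2)
  have h3 : |3 ^ n * (y - (r : ℕ) / 2)| ≤ 1 := abs_le.2 ⟨by linarith [hb.1], by linarith [hb.2]⟩
  rw [abs_mul, abs_of_pos (show (0 : ℝ) < 3 ^ n by positivity)] at h3
  linarith

/-- A horizontal line crossing a column of stacked cells inside them has the height of a row of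
segments. -/
theorem eq_add_half_of_stacked (hD : D.Nonempty) (hr : ∀ j ≠ r, ∃ i, (i, j) ∉ D) {y : ℝ}
    (h : ∀ u ∈ Ioo (0 : ℝ) 1, ∃ j : ℤ, planePoint u (y - j) ∈ fractalSquare 3 D) :
    ∃ j : ℤ, y = j + (r : ℕ) / 2 := by
  -- At an integer height the line may alternate between the cells above and below, so it need not
  -- be contained in a single cell.
  by_cases hy : ∃ n : ℤ, y = n
  · obtain ⟨n, rfl⟩ := hy
    have hb : ∀ {u : ℝ} {j : ℤ}, planePoint u ((n : ℝ) - j) ∈ fractalSquare 3 D →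
        n - j = 0 ∨ n - j = 1 := fun {u j} hm => by
      have h1 := sub_mem_Icc_of_mem hD hm
      have h2 : 0 ≤ n - j := by exact_mod_cast h1.1
      have h3 : n - j ≤ 1 := by exact_mod_cast h1.2
      omega
    by_cases h0 : r = 0
    · exact ⟨n, by simp [h0]⟩
    by_cases h2 : r = 2
    · exact ⟨n - 1, by simp [h2]⟩
    exfalso
    -- For `r = 1`, in a column missing the bottom digit only the lower cell can carry the line, and
    -- it does so through its top digit. Its whole top edge is then present, forcing `r = 2`.
    obtain ⟨i, hi⟩ := hr 0 (Ne.symm h0)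
    refine h2 (row_eq_two_of_line_subset hD hr fun u hu => ?_)
    obtain ⟨j, hj⟩ := h _ (column_mem_Ioo i hu)
    obtain ⟨a, ha, ham⟩ := exists_row_of_mem_column hD hu hj
    have hab := sub_mem_Icc_of_mem hD ham
    have ha0 : (a : ℕ) ≠ 0 := fun e => hi ((Fin.ext e : a = 0) ▸ ha)
    have ha1 : (1 : ℝ) ≤ (a : ℕ) := by exact_mod_cast Nat.one_le_iff_ne_zero.2 ha0
    rcases hb hj with e | e
    · have e' : (n : ℝ) - j = 0 := by exact_mod_cast e
      rw [e'] at hab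
      linarith [hab.1]
    · have e' : (n : ℝ) - j = 1 := by exact_mod_cast e
      rw [e'] at hab ham
      have ha2 : (a : ℕ) = 2 := by
        have : (1 : ℝ) < (a : ℕ) + 1 := by linarith
        have h3 : (2 : ℝ) ≤ (a : ℕ) := by linarith [hab.2]
        have h4 : 2 ≤ (a : ℕ) := by exact_mod_cast h3
        omega
      rw [ha2] at ham
      convert ham using 2
      norm_num
  · refine ⟨⌊y⌋, ?_⟩
    have key : ∀ u ∈ Ioo (0 : ℝ) 1, planePoint u (y - ⌊y⌋) ∈ fractalSquare 3 D := fun u hu => by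
      obtain ⟨j, hj⟩ := h u hu
      have hb := sub_mem_Icc_of_mem hD hj
      have : ⌊y⌋ = j := by
        refine Int.floor_eq_iff.2 ⟨by linarith [hb.1], lt_of_le_of_ne (by linarith [hb.2]) ?_⟩
        intro e
        exact hy ⟨j + 1, by push_cast; exact e⟩
      rwa [this]
    linarith [eq_half_of_line_subset hD hr key]

/-- The segment spanned by a full row. -/
theorem planePoint_mem_of_row (hD : D.Nonempty) (hrow : ∀ i, (i, r) ∈ D) {u : ℝ}
    (hu : u ∈ Icc (0 : ℝ) 1) : planePoint u ((r : ℕ) / 2) ∈ fractalSquare 3 D := by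
  have key : ∀ n : ℕ, ∀ u ∈ Icc (0 : ℝ) 1, ∃ z ∈ fractalSquare 3 D,
      |planePoint u ((r : ℕ) / 2) 0 - z 0| ≤ (1 / 3) ^ n ∧
      |planePoint u ((r : ℕ) / 2) 1 - z 1| ≤ (1 / 3) ^ n := by
    intro n
    induction n with
    | zero =>
      intro u hu
      obtain ⟨z, hz⟩ := nonempty_fractalSquare hD
      have h0 := coordinate_mem_Icc hD hz 0
      have h1 := coordinate_mem_Icc hD hz 1
      have h2 : (0 : ℝ) ≤ (r : ℕ) := Nat.cast_nonneg _
      have h3 : ((r : ℕ) : ℝ) ≤ 2 := by exact_mod_cast (by omega : (r : ℕ) ≤ 2)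
      refine ⟨z, hz, ?_, ?_⟩
      · rw [planePoint_zero, pow_zero, abs_le]
        constructor <;> linarith [h0.1, h0.2, hu.1, hu.2]
      · rw [planePoint_one, pow_zero, abs_le]
        constructor <;> linarith [h1.1, h1.2]
    | succ n ih =>
      intro u hu
      obtain ⟨i, hi⟩ : ∃ i : Fin 3, 3 * u - (i : ℕ) ∈ Icc (0 : ℝ) 1 := by
        rcases le_or_gt u (1 / 3) with h | h
        · exact ⟨0, by constructor <;> norm_num <;> linarith [hu.1]⟩
        rcases le_or_gt u (2 / 3) with h' | h'
        · exact ⟨1, by constructor <;> norm_num <;> linarith⟩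
        · exact ⟨2, by constructor <;> norm_num <;> linarith [hu.2]⟩
      obtain ⟨z, hz, h0, h1⟩ := ih _ hi
      refine ⟨_, digitMap_mem hD (hrow i) hz, ?_, ?_⟩
      · rw [planePoint_zero] at h0 ⊢
        rw [digitMap_zero, pow_succ]
        rw [abs_le] at h0 ⊢
        dsimp only
        constructor <;> linarith [h0.1, h0.2]
      · rw [planePoint_one] at h1 ⊢
        rw [digitMap_one, pow_succ]
        rw [abs_le] at h1 ⊢
        dsimp only
        constructor <;> linarith [h1.1, h1.2]
  rw [← (isCompact_fractalSquare hD).isClosed.closure_eq, Metric.mem_closure_iff]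
  intro ε hε
  obtain ⟨n, hn⟩ := exists_pow_lt_of_lt_one (half_pos hε) (show (1 / 3 : ℝ) < 1 by norm_num)
  obtain ⟨z, hz, h0, h1⟩ := key n u hu
  exact ⟨z, hz, (dist_le_of_coordinates h0 h1).trans_lt (by linarith)⟩

end FullRow

/-! ### Fractal squares as decorated spaces -/

section Decorated

variable {D : Finset (Fin 3 × Fin 3)} {r : Fin 3}

theorem IsPreconnected.image_val {K : Set Plane} {S : Set K} (hS : IsPreconnected S) :
    IsPreconnected (Subtype.val '' S) :=
  hS.image _ continuous_subtype_val.continuousOn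

theorem planePoint_mem_of_isPreconnected {C : Set Plane} (hC : IsPreconnected C)
    (hH : ∀ x ∈ C, ∀ y ∈ C, x 1 = y 1) {x y : Plane} (hx : x ∈ C) (hy : y ∈ C) {u : ℝ}
    (hu : u ∈ Icc (x 0) (y 0)) : planePoint u (x 1) ∈ C := by
  obtain ⟨z, hz, hzu⟩ := (hC.image (fun z : Plane => z 0)
    (continuous_coordinate 0).continuousOn).ordConnected.out (mem_image_of_mem _ hx)
    (mem_image_of_mem _ hy) hu
  rwa [← plane_ext (x := z) (y := planePoint u (x 1)) hzu (hH z hz x hx)]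

theorem exists_coordinate_gap {C : Set Plane} (hH : ∀ x ∈ C, ∀ y ∈ C, x 1 = y 1)
    {x y : Plane} (hx : x ∈ C) (hy : y ∈ C) {ε : ℝ} (h : 2 * ε < dist x y) :
    ∃ x ∈ C, ∃ y ∈ C, x 0 + ε < y 0 := by
  by_contra! hcon
  have hε : 0 ≤ ε := by linarith [hcon x hx x hx]
  refine absurd (dist_le_of_coordinates (ε := ε) ?_ ?_) (not_le.2 h)
  · rw [abs_le]; constructor <;> linarith [hcon x hx y hy, hcon y hy x hx]
  · rw [hH x hx y hy, sub_self, abs_zero]; exact hε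

/-- The point in the middle of a crossing of the column `a` at height `j + r / 2`, at level `k`. -/
noncomputable def crossingPoint (r : Fin 3) (k : ℕ) (a j : ℤ) : Plane :=
  planePoint ((a + 1 / 2) / 3 ^ k) ((j + (r : ℕ) / 2) / 3 ^ k)

/-- A horizontal set this long traverses a whole column of level `k`, where its height is forced to
be that of a row of segments. The bound `-1` for `j` occurs because `r / 2` may be as large as `1`.
-/
theorem exists_crossingPoint_mem (hD : D.Nonempty) (hr : ∀ j ≠ r, ∃ i, (i, j) ∉ D) {C : Set Plane}
    (hC : IsPreconnected C) (hCK : C ⊆ fractalSquare 3 D) (hH : ∀ x ∈ C, ∀ y ∈ C, x 1 = y 1)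
    {k : ℕ} {x y : Plane} (hx : x ∈ C) (hy : y ∈ C) (h : x 0 + 2 * (1 / 3) ^ k < y 0) :
    ∃ a ∈ Icc (0 : ℤ) (3 ^ k), ∃ j ∈ Icc (-1 : ℤ) (3 ^ k), crossingPoint r k a j ∈ C := by
  have hpos : (0 : ℝ) < 3 ^ k := by positivity
  have hx0 := coordinate_mem_Icc hD (hCK hx) 0
  have hy0 := coordinate_mem_Icc hD (hCK hy) 0
  have hx1 := coordinate_mem_Icc hD (hCK hx) 1
  -- Rounding up loses less than one column width, so a length above two widths leaves the column
  -- from `a` to `a + 1` fully traversed.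
  set a : ℤ := ⌈3 ^ k * x 0⌉ with ha
  have ha1 : 3 ^ k * x 0 ≤ a := Int.le_ceil _
  have ha2 : (a : ℝ) < 3 ^ k * x 0 + 1 := Int.ceil_lt_add_one _
  have hy' : (a : ℝ) + 1 < 3 ^ k * y 0 := by
    have : 3 ^ k * (x 0 + 2 * (1 / 3) ^ k) < 3 ^ k * y 0 := mul_lt_mul_of_pos_left h hpos
    rw [mul_add, mul_left_comm, ← mul_pow] at this
    norm_num at this
    linarith
  have hline : ∀ u ∈ Ioo (0 : ℝ) 1, planePoint ((a + u) / 3 ^ k) (x 1) ∈ C := fun u hu => by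
    refine planePoint_mem_of_isPreconnected hC hH hx hy ⟨?_, ?_⟩
    · rw [le_div_iff₀ hpos]; linarith [hu.1]
    · rw [div_le_iff₀ hpos]; linarith [hu.2]
  obtain ⟨j, hj⟩ := eq_add_half_of_stacked hD hr (y := 3 ^ k * x 1) fun u hu => by
    obtain ⟨v, -, hv⟩ := exists_address hD (hCK (hline u hu)) k
    refine ⟨v.2, ?_⟩
    have hb := coordinate_mem_Icc hD hv 0
    have e : 3 ^ k * ((a + u) / 3 ^ k) = a + u := by field_simp
    simp only [zoom, planePoint_zero, planePoint_one, e] at hv hb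
    have hva : v.1 = a := by
      have h1 : (v.1 : ℝ) < a + 1 := by linarith [hb.1, hu.2]
      have h2 : (a : ℝ) < v.1 + 1 := by linarith [hb.2, hu.1]
      have h3 : v.1 < a + 1 := by exact_mod_cast h1
      have h4 : a < v.1 + 1 := by exact_mod_cast h2
      omega
    rwa [hva, add_sub_cancel_left] at hv
  have hr1 : (0 : ℝ) ≤ (r : ℕ) := Nat.cast_nonneg _
  have hr2 : ((r : ℕ) : ℝ) ≤ 2 := by exact_mod_cast (by omega : (r : ℕ) ≤ 2)
  refine ⟨a, ⟨?_, ?_⟩, j, ⟨?_, ?_⟩, ?_⟩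
  · have : (-1 : ℝ) < a := by nlinarith [hx0.1]
    have : (-1 : ℤ) < a := by exact_mod_cast this
    omega
  · have : (a : ℝ) ≤ 3 ^ k := by nlinarith [hy0.2]
    exact_mod_cast this
  · have : (-1 : ℝ) ≤ j := by nlinarith [hx1.1]
    exact_mod_cast this
  · have : (j : ℝ) ≤ 3 ^ k := by nlinarith [hx1.2]
    exact_mod_cast this
  · have := hline _ half_mem_Ioo
    rwa [show x 1 = (j + (r : ℕ) / 2) / 3 ^ k by rw [← hj]; field_simp] at this

/-- A large component contains one of the finitely many crossing points of a suitable level, and is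
determined by it. -/
theorem finite_large_components (hD : D.Nonempty) (hr : ∀ j ≠ r, ∃ i, (i, j) ∉ D)
    (hH : ∀ C ⊆ fractalSquare 3 D, IsPreconnected C → ∀ x ∈ C, ∀ y ∈ C, x 1 = y 1)
    {ε : ℝ} (hε : 0 < ε) :
    {S : Set (fractalSquare 3 D) | (∃ x, S = connectedComponent x) ∧ ε ≤ diam S}.Finite := by
  classical
  obtain ⟨k, hk⟩ := exists_pow_lt_of_lt_one (show (0 : ℝ) < ε / 8 by positivity)
    (show (1 / 3 : ℝ) < 1 by norm_num)
  let f : ℤ × ℤ → Set (fractalSquare 3 D) := fun q =>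
    if h : crossingPoint r k q.1 q.2 ∈ fractalSquare 3 D then connectedComponent ⟨_, h⟩ else ∅
  refine (((finite_Icc (0 : ℤ) (3 ^ k)).prod (finite_Icc (-1 : ℤ) (3 ^ k))).image f).subset ?_
  rintro _ ⟨⟨x, rfl⟩, hd⟩
  set C : Set Plane := Subtype.val '' connectedComponent x with hCdef
  have hC : IsPreconnected C := isPreconnected_connectedComponent.image_val
  have hCK : C ⊆ fractalSquare 3 D := by rintro _ ⟨y, -, rfl⟩; exact y.2
  have hHC := hH C hCK hC
  have hgap : ∃ y ∈ C, ∃ z ∈ C, 2 * (2 * (1 / 3) ^ k) < dist y z := by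
    by_contra! hcon
    have : diam (connectedComponent x) ≤ 2 * (2 * (1 / 3) ^ k) :=
      diam_le_of_forall_dist_le (by positivity) fun y hy z hz =>
        hcon y ⟨y, hy, rfl⟩ z ⟨z, hz, rfl⟩
    linarith
  obtain ⟨y, hy, z, hz, hyz⟩ := hgap
  obtain ⟨y, hy, z, hz, hyz⟩ := exists_coordinate_gap hHC hy hz hyz
  obtain ⟨a, ha, j, hj, w, hw, hwC⟩ := exists_crossingPoint_mem hD hr hC hCK hHC hy hz hyz
  refine ⟨(a, j), ⟨ha, hj⟩, ?_⟩
  have hmem : crossingPoint r k a j ∈ fractalSquare 3 D := hwC ▸ w.2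
  have e : (⟨crossingPoint r k a j, hmem⟩ : fractalSquare 3 D) = w := Subtype.ext hwC.symm
  simp only [f, dif_pos hmem, e]
  exact (connectedComponent_eq hw).symm

theorem isCopyComponent_of_nontrivial (hD : D.Nonempty)
    (hH : ∀ C ⊆ fractalSquare 3 D, IsPreconnected C → ∀ x ∈ C, ∀ y ∈ C, x 1 = y 1)
    {x : fractalSquare 3 D} (hx : (connectedComponent x).Nontrivial) :
    IsCopyComponent unitInterval (connectedComponent x) := by
  have : CompactSpace (fractalSquare 3 D) :=
    isCompact_iff_compactSpace.1 (isCompact_fractalSquare hD)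
  refine ⟨⟨x, rfl⟩, ?_⟩
  set S := connectedComponent x with hS
  set C : Set Plane := Subtype.val '' S with hCdef
  have hC : IsPreconnected C := isPreconnected_connectedComponent.image_val
  have hCK : C ⊆ fractalSquare 3 D := by rintro _ ⟨y, -, rfl⟩; exact y.2
  have hHC := hH C hCK hC
  have hcpt : IsCompact C := isClosed_connectedComponent.isCompact.image continuous_subtype_val
  have hne : C.Nonempty := ⟨x, x, mem_connectedComponent, rfl⟩
  obtain ⟨p, hp, hpmin⟩ := hcpt.exists_isMinOn hne (continuous_coordinate 0).continuousOn
  obtain ⟨q, hq, hqmax⟩ := hcpt.exists_isMaxOn hne (continuous_coordinate 0).continuousOn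
  have hpq : p 0 < q 0 := by
    obtain ⟨y, hy, z, hz, hyz⟩ := hx
    have hy' : y.1 ∈ C := ⟨y, hy, rfl⟩
    have hz' : z.1 ∈ C := ⟨z, hz, rfl⟩
    by_contra! hle
    have e1 : p 0 ≤ y.1 0 := hpmin hy'
    have e2 : y.1 0 ≤ q 0 := hqmax hy'
    have e3 : p 0 ≤ z.1 0 := hpmin hz'
    have e4 : z.1 0 ≤ q 0 := hqmax hz'
    exact hyz (Subtype.ext (plane_ext (by linarith) (hHC _ hy' _ hz')))
  have hmem : ∀ t : unitInterval, planePoint (p 0 + t * (q 0 - p 0)) (p 1) ∈ C := fun t => by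
    refine planePoint_mem_of_isPreconnected hC hHC hp hq ⟨?_, ?_⟩
    · nlinarith [t.2.1]
    · nlinarith [t.2.2]
  refine ⟨fun t => ⟨_, hCK (hmem t)⟩, ?_, ?_, ?_⟩
  · exact (continuous_planePoint (by fun_prop) continuous_const).subtype_mk _
  · intro s t hst
    have h0 := congrArg (fun z : fractalSquare 3 D => z.1 0) hst
    simp only [planePoint_zero] at h0
    have : (s : ℝ) * (q 0 - p 0) = t * (q 0 - p 0) := by linarith
    exact Subtype.ext (mul_right_cancel₀ (sub_pos.2 hpq).ne' this)
  · ext y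
    constructor
    · rintro ⟨t, rfl⟩
      obtain ⟨z, hz, hzt⟩ := hmem t
      convert hz
      exact Subtype.ext hzt.symm
    · intro hy
      have hy' : y.1 ∈ C := ⟨y, hy, rfl⟩
      have e1 : p 0 ≤ y.1 0 := hpmin hy'
      have e2 : y.1 0 ≤ q 0 := hqmax hy'
      have hpos := sub_pos.2 hpq
      refine ⟨⟨(y.1 0 - p 0) / (q 0 - p 0), div_nonneg (by linarith) hpos.le,
        (div_le_one hpos).2 (by linarith)⟩, Subtype.ext (plane_ext ?_ (hHC _ hp _ hy'))⟩
      simp only [planePoint_zero]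
      field_simp
      ring

theorem exists_address_subset (hD : D.Nonempty) {U : Set (fractalSquare 3 D)} (hU : IsOpen U)
    {x : fractalSquare 3 D} (hx : x ∈ U) : ∃ ε > 0, ball x ε ⊆ U ∧ ∃ k, ∃ v ∈ addresses D k,
      ∀ y : fractalSquare 3 D, zoom k v y ∈ fractalSquare 3 D → dist y x < ε / 2 := by
  obtain ⟨ε, hε, hεU⟩ := Metric.isOpen_iff.1 hU x hx
  obtain ⟨k, hk⟩ := exists_pow_lt_of_lt_one (show (0 : ℝ) < ε / 4 by positivity)
    (show (1 / 3 : ℝ) < 1 by norm_num)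
  obtain ⟨v, hv, hvx⟩ := exists_address hD x.2 k
  exact ⟨ε, hε, hεU, k, v, hv, fun y hy => (dist_le_of_zoom_mem hD hy hvx).trans_lt (by linarith)⟩

/-- A cell inside `U` contains segments, but their components may continue into neighbouring cells.
Infinitely many distinct components are produced there; all but finitely many are small enough to
remain in `U`. -/
theorem exists_two_copies (hD : D.Nonempty) (hrow : ∀ i, (i, r) ∈ D)
    (hr : ∀ j ≠ r, ∃ i, (i, j) ∉ D) (hother : ∃ d ∈ D, d.2 ≠ r)
    (hH : ∀ C ⊆ fractalSquare 3 D, IsPreconnected C → ∀ x ∈ C, ∀ y ∈ C, x 1 = y 1)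
    {U : Set (fractalSquare 3 D)} (hU : IsOpen U) (hne : U.Nonempty) :
    ∃ S T : Set (fractalSquare 3 D), S ≠ T ∧ IsCopyComponent unitInterval S ∧
      IsCopyComponent unitInterval T ∧ S ⊆ U ∧ T ⊆ U := by
  have : CompactSpace (fractalSquare 3 D) :=
    isCompact_iff_compactSpace.1 (isCompact_fractalSquare hD)
  obtain ⟨x, hx⟩ := hne
  obtain ⟨ε, hε, hεU, k, v, hv, hclose⟩ := exists_address_subset hD hU hx
  obtain ⟨d, hd, hdr⟩ := hother
  let w : ℕ → ℤ × ℤ := fun m => Nat.rec v (fun _ p => append p (digitVec d)) m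
  have hw : ∀ m, w m ∈ addresses D (k + m) := fun m => by
    induction m with
    | zero => exact hv
    | succ m ih => exact append_mem_addresses ih hd
  have hzoom : ∀ m z, zoom (k + m) (w m) z ∈ fractalSquare 3 D → zoom k v z ∈ fractalSquare 3 D :=
    fun m z h => by
      induction m with
      | zero => exact h
      | succ m ih => exact ih (zoom_mem_of_append hD hd h)
  have hwm : ∀ m, ((w m).2 : ℝ) + (d.2 : ℕ) / 2 = 3 ^ m * (v.2 + (d.2 : ℕ) / 2) := fun m => by
    induction m with
    | zero => simp [w]
    | succ m ih =>
      have : (w (m + 1)).2 = 3 * (w m).2 + (d.2 : ℕ) := rfl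
      rw [this, pow_succ]
      push_cast
      linarith
  let pt : ℕ → ℝ → Plane := fun m u => unzoom (k + m) (w m) (planePoint u ((r : ℕ) / 2))
  have hpt : ∀ m, ∀ u ∈ Icc (0 : ℝ) 1, pt m u ∈ fractalSquare 3 D := fun m u hu =>
    unzoom_mem hD (hw m) (planePoint_mem_of_row hD hrow hu)
  have hpc : ∀ m, Continuous (pt m) := fun m =>
    continuous_planePoint (by simp only [planePoint_zero]; fun_prop)
      (by simp only [planePoint_one]; fun_prop)
  let P : ℕ → fractalSquare 3 D := fun m => ⟨pt m 0, hpt m 0 (by simp)⟩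
  have hmem : ∀ m, ∀ u (hu : u ∈ Icc (0 : ℝ) 1),
      (⟨pt m u, hpt m u hu⟩ : fractalSquare 3 D) ∈ connectedComponent (P m) := by
    intro m u hu
    have hcon : IsPreconnected (range fun u : unitInterval =>
        (⟨pt m u, hpt m u u.2⟩ : fractalSquare 3 D)) :=
      isPreconnected_range (((hpc m).comp continuous_subtype_val).subtype_mk _)
    exact hcon.subset_connectedComponent ⟨0, rfl⟩ ⟨⟨u, hu⟩, rfl⟩
  have hcopy : ∀ m, IsCopyComponent unitInterval (connectedComponent (P m)) := fun m => by
    refine isCopyComponent_of_nontrivial hD hH ⟨P m, mem_connectedComponent, _,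
      hmem m 1 (by simp), fun h => ?_⟩
    have h0 := congrArg (fun z : fractalSquare 3 D => z.1 0) h
    simp only [P, pt, unzoom, planePoint_zero] at h0
    field_simp at h0
    linarith
  have hinj : Function.Injective fun m => connectedComponent (P m) := by
    intro m n hmn
    have hHC := hH (Subtype.val '' connectedComponent (P m))
      (by rintro _ ⟨y, -, rfl⟩; exact y.2) isPreconnected_connectedComponent.image_val
      _ ⟨P m, mem_connectedComponent, rfl⟩ _
      ⟨P n, (show connectedComponent (P m) = connectedComponent (P n) from hmn) ▸
        mem_connectedComponent, rfl⟩
    -- Repeating the digit `d` makes the heights converge geometrically; since `d` lies outside row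
    -- `r`, the factor is nonzero and the heights are distinct.
    have hheight : ∀ m, (P m).1 1 = (v.2 + (d.2 : ℕ) / 2) / 3 ^ k +
        ((r : ℕ) - (d.2 : ℕ)) / 2 / 3 ^ k * (1 / 3) ^ m := fun m => by
      have h1 := hwm m
      have h2 : ((w m).2 : ℝ) = 3 ^ m * (v.2 + (d.2 : ℕ) / 2) - (d.2 : ℕ) / 2 := by linarith
      simp only [P, pt, unzoom, planePoint_one, h2, pow_add, one_div, inv_pow]
      field_simp
      ring
    rw [hheight, hheight, add_right_inj] at hHC
    have hne : ((r : ℕ) - (d.2 : ℕ) : ℝ) / 2 / 3 ^ k ≠ 0 := by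
      have : ((r : ℕ) : ℝ) ≠ (d.2 : ℕ) := fun e => hdr (Fin.ext (by exact_mod_cast e.symm))
      exact div_ne_zero (div_ne_zero (sub_ne_zero.2 this) two_ne_zero) (by positivity)
    exact pow_right_injective₀ (by norm_num) (by norm_num) (mul_left_cancel₀ hne hHC)
  have hsmall : {m | ¬ ε / 2 ≤ diam (connectedComponent (P m))}.Infinite := by
    refine Finite.infinite_compl (s := {m | ε / 2 ≤ diam (connectedComponent (P m))}) ?_
    exact ((finite_large_components hD hr hH (half_pos hε)).preimage hinj.injOn).subset
      fun m hm => ⟨⟨P m, rfl⟩, hm⟩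
  have hsub : ∀ m, ¬ ε / 2 ≤ diam (connectedComponent (P m)) → connectedComponent (P m) ⊆ U := by
    intro m hm y hy
    refine hεU ?_
    have h1 := hclose (P m) (hzoom m _ (by
      rw [zoom_unzoom]; exact planePoint_mem_of_row hD hrow (by simp)))
    have h2 := dist_le_diam_of_mem (isClosed_connectedComponent.isCompact.isBounded) hy
      (mem_connectedComponent (x := P m))
    rw [mem_ball]
    linarith [dist_triangle y (P m) x]
  obtain ⟨m, hm, n, hn, hmn⟩ := hsmall.nontrivial
  exact ⟨_, _, hinj.ne hmn, hcopy m, hcopy n, hsub m hm, hsub n hn⟩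

/-- Fractal squares with one full row, no other full row and horizontal components are decorated by
arcs. -/
theorem isDecorated_of_row (hD : D.Nonempty) (hrow : ∀ i, (i, r) ∈ D)
    (hr : ∀ j ≠ r, ∃ i, (i, j) ∉ D) (hother : ∃ d ∈ D, d.2 ≠ r)
    (hH : ∀ C ⊆ fractalSquare 3 D, IsPreconnected C → ∀ x ∈ C, ∀ y ∈ C, x 1 = y 1) :
    IsDecorated unitInterval (fractalSquare 3 D) where
  component x := (connectedComponent x).subsingleton_or_nontrivial.imp_right
    (isCopyComponent_of_nontrivial hD hH)
  null _ hε := finite_large_components hD hr hH hε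
  dense _ hU hne := exists_two_copies hD hrow hr hother hH hU hne

theorem totallyDisconnectedSpace_of_coordinates
    (h : ∀ i, ∀ C ⊆ fractalSquare 3 D, IsPreconnected C → ∀ x ∈ C, ∀ y ∈ C, x i = y i) :
    TotallyDisconnectedSpace (fractalSquare 3 D) := by
  refine ⟨fun S _ hS x hx y hy => Subtype.ext ?_⟩
  have key := fun i => h i (Subtype.val '' S) (by rintro _ ⟨z, -, rfl⟩; exact z.2) hS.image_val
    _ ⟨x, hx, rfl⟩ _ ⟨y, hy, rfl⟩
  exact plane_ext (key 0) (key 1)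

theorem nontrivial_fractalSquare (hD : D.Nontrivial) : (fractalSquare 3 D).Nontrivial := by
  obtain ⟨d, hd, e, he, hde⟩ := hD
  have hne : D.Nonempty := ⟨d, hd⟩
  refine ⟨_, planePoint_half_mem hne hd, _, planePoint_half_mem hne he, fun h => hde ?_⟩
  have h0 := congrArg (fun z : Plane => z 0) h
  have h1 := congrArg (fun z : Plane => z 1) h
  simp only [planePoint_zero, planePoint_one, div_left_inj' (two_ne_zero' ℝ), Nat.cast_inj] at h0 h1
  exact Prod.ext (Fin.ext h0) (Fin.ext h1)

theorem nontrivial_of_isOpen (hD : D.Nontrivial) {U : Set (fractalSquare 3 D)} (hU : IsOpen U)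
    (hne : U.Nonempty) : U.Nontrivial := by
  obtain ⟨x, hx⟩ := hne
  have hD' := hD.nonempty
  obtain ⟨ε, hε, hεU, k, v, hv, hclose⟩ := exists_address_subset hD' hU hx
  obtain ⟨y, hy, z, hz, hyz⟩ := nontrivial_fractalSquare hD
  have key : ∀ y (hy : y ∈ fractalSquare 3 D), (⟨_, unzoom_mem hD' hv hy⟩ : fractalSquare 3 D) ∈ U :=
    fun y hy => hεU (by
      have := hclose ⟨_, unzoom_mem hD' hv hy⟩ (by rwa [zoom_unzoom])
      rw [mem_ball]; linarith)
  refine ⟨_, key y hy, _, key z hz, fun h => hyz ?_⟩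
  rw [← zoom_unzoom k v y, ← zoom_unzoom k v z]
  exact congrArg (zoom k v) (congrArg Subtype.val h)

theorem isDecorated_unit_fractalSquare (hD : D.Nontrivial)
    [TotallyDisconnectedSpace (fractalSquare 3 D)] : IsDecorated Unit (fractalSquare 3 D) :=
  isDecorated_unit fun _ hU hne => nontrivial_of_isOpen hD hU hne

end Decorated

/-! ### Affine equivalence of digit sets -/

section Affine

/-- The affine map `x ↦ (a x₀ + b x₁ + p / 2, c x₀ + d x₁ + q / 2)`, for `M = (a, b, c, d, p, q)`. -/
noncomputable def affineMap (M : ℤ × ℤ × ℤ × ℤ × ℤ × ℤ) (x : Plane) : Plane :=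
  planePoint (M.1 * x 0 + M.2.1 * x 1 + M.2.2.2.2.1 / 2)
    (M.2.2.1 * x 0 + M.2.2.2.1 * x 1 + M.2.2.2.2.2 / 2)

/-- The integer affine map `v ↦ (a v₀ + b v₁ + p, c v₀ + d v₁ + q)`, for `M = (a, b, c, d, p, q)`. -/
def intAffineMap (M : ℤ × ℤ × ℤ × ℤ × ℤ × ℤ) (v : ℤ × ℤ) : ℤ × ℤ :=
  (M.1 * v.1 + M.2.1 * v.2 + M.2.2.2.2.1, M.2.2.1 * v.1 + M.2.2.2.1 * v.2 + M.2.2.2.2.2)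

variable {M : ℤ × ℤ × ℤ × ℤ × ℤ × ℤ}

theorem affineMap_injective (hM : M.1 * M.2.2.2.1 - M.2.1 * M.2.2.1 ≠ 0) :
    Function.Injective (affineMap M) := by
  obtain ⟨a, b, c, d, p, q⟩ := M
  have hdet : (a * d - b * c : ℝ) ≠ 0 := by exact_mod_cast hM
  intro x y h
  have h0 := congrArg (fun z : Plane => z 0) h
  have h1 := congrArg (fun z : Plane => z 1) h
  simp only [affineMap, planePoint_zero, planePoint_one] at h0 h1
  refine plane_ext (mul_left_cancel₀ hdet ?_) (mul_left_cancel₀ hdet ?_)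
  · linear_combination (d : ℝ) * h0 - b * h1
  · linear_combination (a : ℝ) * h1 - c * h0

theorem continuous_affineMap : Continuous (affineMap M) :=
  continuous_planePoint (by fun_prop) (by fun_prop)

/-- Translating all digits by `(p, q)` translates the fractal square by the sum of `(p, q) / 3 ^ n`
over `n ≥ 1`, which is `(p, q) / 2`; hence the halves in `affineMap`. -/
theorem affineMap_digitMap {d e : Fin 3 × Fin 3} (h : intAffineMap M (digitVec d) = digitVec e)
    (x : Plane) : affineMap M (digitMap 3 d x) = digitMap 3 e (affineMap M x) := by
  have h0 := congrArg (fun v : ℤ × ℤ => (v.1 : ℝ)) h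
  have h1 := congrArg (fun v : ℤ × ℤ => (v.2 : ℝ)) h
  simp only [intAffineMap, digitVec] at h0 h1
  push_cast at h0 h1
  refine plane_ext ?_ ?_
  · simp only [affineMap, planePoint_zero, digitMap_zero, digitMap_one, ← h0]; ring
  · simp only [affineMap, planePoint_one, digitMap_zero, digitMap_one, ← h1]; ring

theorem digitVec_injective : Function.Injective digitVec := fun d e h => by
  simp only [digitVec, Prod.mk.injEq, Nat.cast_inj] at h
  exact Prod.ext (Fin.ext h.1) (Fin.ext h.2)

/-- The affine image satisfies the self-similarity equation of `E`, so it is the fractal square by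
uniqueness. Inclusion of the digits suffices because the cardinalities agree. -/
theorem nonempty_homeomorph_of_intAffineMap {D E : Finset (Fin 3 × Fin 3)} (hD : D.Nonempty)
    (hM : M.1 * M.2.2.2.1 - M.2.1 * M.2.2.1 ≠ 0) (hcard : E.card = D.card)
    (h : ∀ d ∈ D, ∃ e ∈ E, intAffineMap M (digitVec d) = digitVec e) :
    Nonempty (fractalSquare 3 D ≃ₜ fractalSquare 3 E) := by
  choose! g hgE hg using h
  have hinj : InjOn g D := fun d hd e he hde => by
    refine digitVec_injective ?_
    have : intAffineMap M (digitVec d) = intAffineMap M (digitVec e) := by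
      rw [hg d hd, hg e he, hde]
    obtain ⟨a, b, c, a', p, q⟩ := M
    simp only [intAffineMap, Prod.mk.injEq] at this
    refine Prod.ext (mul_left_cancel₀ hM ?_) (mul_left_cancel₀ hM ?_)
    · linear_combination a' * this.1 - b * this.2
    · linear_combination a * this.2 - c * this.1
  have himg : D.image g = E := Finset.eq_of_subset_of_card_le
    (Finset.image_subset_iff.2 hgE) (by rw [Finset.card_image_of_injOn hinj, hcard])
  have hE : E.Nonempty := himg ▸ hD.image g
  have hK := isFractalSquare_fractalSquare 3 (by norm_num) D hD
  have hKE : IsFractalSquare 3 E (affineMap M '' fractalSquare 3 D) := by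
    refine ⟨hK.nonempty.image _, hK.isCompact.image continuous_affineMap, ?_⟩
    conv_lhs => rw [hK.eq_iUnion]
    rw [← himg, Finset.set_biUnion_finset_image, image_iUnion₂]
    refine iUnion₂_congr fun d hd => ?_
    rw [image_image, image_image]
    exact image_congr fun x _ => affineMap_digitMap (hg d hd) x
  have : CompactSpace (fractalSquare 3 D) := isCompact_iff_compactSpace.1 hK.isCompact
  have hemb : IsEmbedding fun x : fractalSquare 3 D => affineMap M x :=
    ((continuous_affineMap.comp continuous_subtype_val).isClosedEmbedding
      ((affineMap_injective hM).comp Subtype.val_injective)).isEmbedding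
  refine ⟨hemb.toHomeomorph.trans (Homeomorph.setCongr ?_)⟩
  rw [hKE.eq_fractalSquare (by norm_num) hE, image_eq_range]

end Affine

/-! ### A connectedness criterion -/

section Connected

variable {D : Finset (Fin 3 × Fin 3)}

/-- The images under two digit maps of the fixed points of two other digit maps coincide. -/
def AdjacentDigits (D : Finset (Fin 3 × Fin 3)) (d e : Fin 3 × Fin 3) : Prop :=
  ∃ a ∈ D, ∃ b ∈ D, (a.1 : ℕ) + 2 * d.1 = b.1 + 2 * e.1 ∧ (a.2 : ℕ) + 2 * d.2 = b.2 + 2 * e.2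

instance (d e : Fin 3 × Fin 3) : Decidable (AdjacentDigits D d e) := by
  unfold AdjacentDigits; infer_instance

/-- Given a separation with gap `ρ`, sufficiently small copies lie on one side. Copies with adjacent
digits share a point, so all subcopies of a copy lie on the same side; climbing back up the levels,
so does the whole set. -/
theorem isConnected_fractalSquare (hD : D.Nonempty)
    (h : ∀ A ∈ D.powerset, A.Nonempty → (∀ d ∈ A, ∀ e ∈ D, AdjacentDigits D d e → e ∈ A) → A = D) :
    IsConnected (fractalSquare 3 D) := by
  classical
  refine ⟨nonempty_fractalSquare hD, ?_⟩
  refine (isPreconnected_iff_subset_of_fully_disjoint_closed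
    (isCompact_fractalSquare hD).isClosed).2 fun u v hu hv huv hdis => ?_
  set K := fractalSquare 3 D with hK
  obtain ⟨ρ, hρ, hsep⟩ := Metric.exists_pos_forall_lt_edist
    ((isCompact_fractalSquare hD).inter_right hu) ((isCompact_fractalSquare hD).isClosed.inter hv)
    (hdis.mono inter_subset_right inter_subset_right)
  have hρ' : (0 : ℝ) < ρ := hρ
  have hsep' : ∀ x ∈ K, x ∈ u → ∀ y ∈ K, y ∈ v → (ρ : ℝ) < dist x y := fun x hx hxu y hy hyv => by
    have := hsep x ⟨hx, hxu⟩ y ⟨hy, hyv⟩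
    rw [edist_nndist] at this
    exact_mod_cast this
  have hdist : ∀ x ∈ K, ∀ y ∈ K, dist x y ≤ 2 := fun x hx y hy => by
    have := dist_le_of_zoom_mem hD (k := 0) (v := (0, 0)) (x := x) (y := y)
      (by rwa [zoom_zero]) (by rwa [zoom_zero])
    simpa using this
  -- Here `k` bounds the number of subdivisions after which the Lipschitz constant is at most `ρ /
  -- 2`; as distances in `K` are at most `2`, such a copy cannot jump the gap.
  have key : ∀ k : ℕ, ∀ g : Plane → Plane, MapsTo g K K →
      (∀ x y, dist (g x) (g y) ≤ 3 ^ k * (ρ / 2) * dist x y) → MapsTo g K u ∨ MapsTo g K v := by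
    intro k
    induction k with
    | zero =>
      intro g hg hdg
      obtain ⟨x, hx⟩ := nonempty_fractalSquare hD
      have hle : ∀ y ∈ K, ∀ z ∈ K, dist (g y) (g z) ≤ ρ := fun y hy z hz => by
        have h1 := hdg y z
        have h2 := hdist y hy z hz
        nlinarith
      by_contra! hcon
      obtain ⟨hnu, hnv⟩ := hcon
      simp only [MapsTo, not_forall] at hnu hnv
      obtain ⟨y, hy, hyu⟩ := hnu
      obtain ⟨z, hz, hzv⟩ := hnv
      have := hsep' _ (hg hz) ((huv (hg hz)).resolve_right hzv) _ (hg hy)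
        ((huv (hg hy)).resolve_left hyu)
      linarith [hle z hz y hy]
    | succ k ih =>
      intro g hg hdg
      have hstep : ∀ d ∈ D, MapsTo (g ∘ digitMap 3 d) K u ∨ MapsTo (g ∘ digitMap 3 d) K v := by
        intro d hd
        refine ih _ (fun x hx => hg (digitMap_mem hD hd hx)) fun x y => ?_
        have h1 := hdg (digitMap 3 d x) (digitMap 3 d y)
        have h2 := (lipschitzWith_digitMap 3 d).dist_le_mul x y
        push_cast at h2
        calc dist (g (digitMap 3 d x)) (g (digitMap 3 d y))
            ≤ 3 ^ (k + 1) * (ρ / 2) * dist (digitMap 3 d x) (digitMap 3 d y) := h1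
          _ ≤ 3 ^ (k + 1) * (ρ / 2) * (3⁻¹ * dist x y) := by gcongr
          _ = 3 ^ k * (ρ / 2) * dist x y := by ring
      have hall : (∀ d ∈ D, MapsTo (g ∘ digitMap 3 d) K u) ∨
          ∀ d ∈ D, MapsTo (g ∘ digitMap 3 d) K v := by
        by_cases hA : (D.filter fun d => MapsTo (g ∘ digitMap 3 d) K u).Nonempty
        · left
          have := h _ (Finset.mem_powerset.2 (Finset.filter_subset _ _)) hA ?_
          · intro d hd
            rw [← this] at hd
            exact (Finset.mem_filter.1 hd).2
          · rintro d hd e he ⟨a, ha, b, hb, h0, h1⟩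
            rw [Finset.mem_filter] at hd ⊢
            refine ⟨he, (hstep e he).resolve_right fun hv' => ?_⟩
            have e1 := hd.2 (planePoint_half_mem hD ha)
            have e2 := hv' (planePoint_half_mem hD hb)
            have h0' : ((a.1 : ℕ) : ℝ) + 2 * (d.1 : ℕ) = (b.1 : ℕ) + 2 * (e.1 : ℕ) := by
              exact_mod_cast h0
            have h1' : ((a.2 : ℕ) : ℝ) + 2 * (d.2 : ℕ) = (b.2 : ℕ) + 2 * (e.2 : ℕ) := by
              exact_mod_cast h1
            have e3 : digitMap 3 d (planePoint ((a.1 : ℕ) / 2) ((a.2 : ℕ) / 2)) =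
                digitMap 3 e (planePoint ((b.1 : ℕ) / 2) ((b.2 : ℕ) / 2)) := by
              refine plane_ext ?_ ?_
              · simp only [digitMap_zero, planePoint_zero]; linarith
              · simp only [digitMap_one, planePoint_one]; linarith
            rw [Function.comp_apply, e3] at e1
            exact disjoint_left.1 hdis e1 e2
        · right
          intro d hd
          refine (hstep d hd).resolve_left fun hu' => hA ⟨d, Finset.mem_filter.2 ⟨hd, hu'⟩⟩
      refine hall.imp (fun H x hx => ?_) (fun H x hx => ?_)
      all_goals
        obtain ⟨d, hd, y, hy, rfl⟩ := exists_digitMap_eq hD hx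
        exact H d hd hy
  obtain ⟨k, hk⟩ := pow_unbounded_of_one_lt (2 / (ρ : ℝ)) (show (1 : ℝ) < 3 by norm_num)
  rw [div_lt_iff₀ hρ'] at hk
  refine key k id (mapsTo_id _) fun x y => ?_
  exact le_mul_of_one_le_left dist_nonneg (by linarith)

end Connected

/-! ### Certificates for the representative digit sets -/

section Certificates

/-- The digit set with the given list of digits. -/
abbrev digitSet (l : List (Fin 3 × Fin 3)) : Finset (Fin 3 × Fin 3) := l.toFinset

theorem digitVec_mem_map {l : List (Fin 3 × Fin 3)} (d : Fin 3 × Fin 3) (hd : d ∈ digitSet l) :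
    digitVec d ∈ l.map digitVec :=
  List.mem_map_of_mem (List.mem_toFinset.1 hd)

theorem isDecorated_of_certificate {l : List (Fin 3 × Fin 3)} {r : Fin 3} {S : List (ℤ × ℤ)}
    {c : ℤ × ℤ → ℤ × ℤ → ℤ × ℤ → ℤ} (hrow : ∀ i, (i, r) ∈ l) (hr : ∀ j ≠ r, ∃ i, (i, j) ∉ l)
    (hother : ∃ d ∈ l, d.2 ≠ r) (hS : closedCarries (l.map digitVec) S = true)
    (hc : labelsAgree (l.map digitVec) S (0, 1) c = true) :
    IsDecorated unitInterval (fractalSquare 3 (digitSet l)) := by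
  have hD : (digitSet l).Nonempty := ⟨_, List.mem_toFinset.2 (hrow 0)⟩
  obtain ⟨d, hd, hdr⟩ := hother
  refine isDecorated_of_row hD (fun i => List.mem_toFinset.2 (hrow i))
    (fun j hj => (hr j hj).imp fun i hi => mt List.mem_toFinset.1 hi)
    ⟨d, List.mem_toFinset.2 hd, hdr⟩ fun C hCK hC x hx y hy => ?_
  simpa using linear_eq_of_isPreconnected hD digitVec_mem_map hS hc hC hCK hx hy

theorem totallyDisconnectedSpace_of_certificates {l : List (Fin 3 × Fin 3)}
    {S : List (ℤ × ℤ)} {φ ψ : ℤ × ℤ} {b c : ℤ × ℤ → ℤ × ℤ → ℤ × ℤ → ℤ} (hl : l ≠ [])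
    (hdet : φ.1 * ψ.2 - φ.2 * ψ.1 ≠ 0) (hS : closedCarries (l.map digitVec) S = true)
    (hb : labelsAgree (l.map digitVec) S φ b = true)
    (hc : labelsAgree (l.map digitVec) S ψ c = true) :
    TotallyDisconnectedSpace (fractalSquare 3 (digitSet l)) := by
  have hD : (digitSet l).Nonempty := List.toFinset_nonempty_iff l |>.2 hl
  have hdet' : (φ.1 * ψ.2 - φ.2 * ψ.1 : ℝ) ≠ 0 := by exact_mod_cast hdet
  refine totallyDisconnectedSpace_of_coordinates fun i C hCK hC x hx y hy => ?_
  have h1 := linear_eq_of_isPreconnected hD digitVec_mem_map hS hb hC hCK hx hy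
  have h2 := linear_eq_of_isPreconnected hD digitVec_mem_map hS hc hC hCK hx hy
  refine mul_left_cancel₀ hdet' ?_
  fin_cases i
  · change (φ.1 * ψ.2 - φ.2 * ψ.1 : ℝ) * x 0 = (φ.1 * ψ.2 - φ.2 * ψ.1 : ℝ) * y 0
    linear_combination (ψ.2 : ℝ) * h1 - φ.2 * h2
  · change (φ.1 * ψ.2 - φ.2 * ψ.1 : ℝ) * x 1 = (φ.1 * ψ.2 - φ.2 * ψ.1 : ℝ) * y 1
    linear_combination (φ.1 : ℝ) * h2 - ψ.1 * h1

/-- A function of the last digit, given by a list of values. -/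
def lastDigit (t : List ((ℤ × ℤ) × ℤ)) (_ _ d : ℤ × ℤ) : ℤ := (t.lookup d).getD 0

/-- A function of the last three digits, given by the list of its values. -/
def lastThreeDigits (L : List (ℤ × ℤ)) (t : List ℤ) (d₁ d₂ d₃ : ℤ × ℤ) : ℤ :=
  t.getD (25 * L.idxOf d₁ + 5 * L.idxOf d₂ + L.idxOf d₃) 0

/-- Digit lists whose only touching cells are horizontal neighbours, with a full row. -/
def plainRowLists : List (List (Fin 3 × Fin 3)) := [
  [(0, 0), (0, 1), (1, 0), (1, 1), (2, 0)], [(0, 0), (0, 1), (1, 0), (2, 0), (2, 1)],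
  [(0, 0), (0, 2), (1, 0), (1, 2), (2, 0)], [(0, 0), (0, 2), (1, 0), (2, 0), (2, 2)],
  [(0, 0), (0, 1), (1, 0), (1, 1), (2, 1)], [(0, 0), (0, 1), (1, 1), (1, 2), (2, 1)],
  [(0, 0), (0, 1), (1, 1), (2, 0), (2, 1)]]

/-- The digit lists with a full row, up to symmetry. -/
def rowLists : List (List (Fin 3 × Fin 3)) := plainRowLists ++ [
  [(0, 0), (0, 1), (1, 0), (1, 2), (2, 0)], [(0, 0), (0, 2), (1, 0), (2, 0), (2, 1)]]

/-- The digit lists of totally disconnected fractal squares, up to symmetry. -/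
def cantorLists : List (List (Fin 3 × Fin 3)) := [
  [(0, 0), (0, 1), (1, 2), (2, 0), (2, 1)], [(0, 0), (0, 1), (1, 1), (1, 2), (2, 0)],
  [(0, 0), (0, 1), (1, 0), (1, 2), (2, 1)], [(0, 0), (0, 1), (1, 0), (1, 2), (2, 2)],
  [(0, 0), (0, 1), (1, 2), (2, 0), (2, 2)]]

/-- The digit lists of connected fractal squares, up to affine equivalence. -/
def connectedLists : List (List (Fin 3 × Fin 3)) := [
  [(0, 0), (0, 1), (0, 2), (1, 0), (2, 0)], [(0, 0), (0, 1), (0, 2), (1, 1), (2, 0)],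
  [(0, 0), (0, 1), (0, 2), (1, 1), (2, 1)], [(0, 0), (0, 2), (1, 1), (2, 0), (2, 2)],
  [(0, 1), (1, 0), (1, 1), (1, 2), (2, 1)]]

theorem isDecorated_of_mem_plainRowLists : ∀ l ∈ plainRowLists,
    IsDecorated unitInterval (fractalSquare 3 (digitSet l)) := by
  have h : ∀ l ∈ plainRowLists, closedCarries (l.map digitVec) [(-1, 0), (0, 0), (1, 0)] = true ∧
      labelsAgree (l.map digitVec) [(-1, 0), (0, 0), (1, 0)] (0, 1) (lastDigit []) = true ∧
      ∃ r : Fin 3, (∀ i, (i, r) ∈ l) ∧ (∀ j ≠ r, ∃ i, (i, j) ∉ l) ∧ ∃ d ∈ l, d.2 ≠ r := by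
    decide +kernel
  intro l hl
  obtain ⟨hS, hc, r, hrow, hr, hother⟩ := h l hl
  exact isDecorated_of_certificate hrow hr hother hS hc

theorem isDecorated_of_mem_rowLists : ∀ l ∈ rowLists,
    IsDecorated unitInterval (fractalSquare 3 (digitSet l)) := by
  intro l hl
  rcases List.mem_append.1 hl with hl | hl
  · exact isDecorated_of_mem_plainRowLists l hl
  simp only [List.mem_cons, List.not_mem_nil, or_false] at hl
  rcases hl with rfl | rfl
  · exact isDecorated_of_certificate (r := 0) (S := [(-1, 0), (0, -1), (0, 0), (0, 1), (1, 0)])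
      (c := lastDigit [((0, 1), -1), ((1, 2), 1)]) (by decide) (by decide) (by decide)
      (by decide +kernel) (by decide +kernel)
  · exact isDecorated_of_certificate (r := 0)
      (S := [(-1, 0), (-1, 1), (0, -1), (0, 0), (0, 1), (1, -1), (1, 0)])
      (c := lastDigit [((0, 2), 1), ((2, 1), -1)]) (by decide) (by decide) (by decide)
      (by decide +kernel) (by decide +kernel)

/-- Two independent linear forms constant on connected sets leave only points. Corrections by the
last digit suffice except for one form of the last list. -/
theorem totallyDisconnectedSpace_of_mem_cantorLists : ∀ l ∈ cantorLists,
    TotallyDisconnectedSpace (fractalSquare 3 (digitSet l)) := by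
  intro l hl
  simp only [cantorLists, List.mem_cons, List.not_mem_nil, or_false] at hl
  rcases hl with rfl | rfl | rfl | rfl | rfl
  · exact totallyDisconnectedSpace_of_certificates (S := [(0, 0)]) (φ := (1, 0)) (ψ := (0, 1))
      (b := lastDigit []) (c := lastDigit [])
      (by decide) (by decide) (by decide +kernel) (by decide +kernel) (by decide +kernel)
  · exact totallyDisconnectedSpace_of_certificates (S := [(-1, 0), (0, 0), (1, 0)]) (φ := (1, 0))
      (ψ := (0, 1)) (b := lastDigit [((2, 0), 1), ((1, 1), -1)]) (c := lastDigit [])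
      (by decide) (by decide) (by decide +kernel) (by decide +kernel) (by decide +kernel)
  · exact totallyDisconnectedSpace_of_certificates
      (S := [(-1, 0), (0, -1), (0, 0), (0, 1), (1, 0)]) (φ := (1, 0)) (ψ := (0, 1))
      (b := lastDigit [((1, 0), -1), ((1, 2), -1), ((2, 1), 1)])
      (c := lastDigit [((0, 1), -1), ((1, 2), 1), ((2, 1), -1)])
      (by decide) (by decide) (by decide +kernel) (by decide +kernel) (by decide +kernel)
  · exact totallyDisconnectedSpace_of_certificates
      (S := [(-1, -1), (0, -1), (0, 0), (0, 1), (1, 1)]) (φ := (1, 0)) (ψ := (0, 1))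
      (b := lastDigit [((2, 2), 1), ((1, 2), -1), ((1, 0), -1)])
      (c := lastDigit [((0, 1), -1), ((2, 2), 1), ((1, 2), -2), ((1, 0), -3)])
      (by decide) (by decide) (by decide +kernel) (by decide +kernel) (by decide +kernel)
  · exact totallyDisconnectedSpace_of_certificates
      (S := [(-1, -1), (-1, 0), (0, -1), (0, 0), (0, 1), (1, 0), (1, 1)]) (φ := (1, 0))
      (ψ := (1, -1)) (c := lastDigit [((0, 1), 1), ((2, 0), 1), ((1, 2), 1)])
      (b := lastThreeDigits [(0, 0), (0, 1), (1, 2), (2, 0), (2, 2)] [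
        0, 0, -1, 0, -2, 0, 0, -1, -2, -2, -3, -3, -4, 0, -5, 0, 0, -1, 0, -2, -1, -1, -2, 0, -3,
        0, 0, -1, 0, -2, 0, 0, -1, -2, -2, -3, -3, -4, 0, -5, -6, -6, -7, -3, -8, -1, -1, -2, 0,
        -3, -4, -4, -5, 0, -6, 0, 0, -1, -6, -2, -3, -3, -4, 0, -5, 12, 12, 11, 0, 10, -1, -1, -2,
        0, -3, -4, -4, -5, 0, -6, 0, 0, -1, -6, -2, -3, -3, -4, 4, -5, 3, 3, 2, 1, 1, 3, 3, 2, 0,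
        1, -1, -1, -2, 0, -3, 9, 9, 8, -3, 7, 6, 6, 5, 4, 4, 0, 0, -1, 0, -2, 3, 3, 2, 0, 1])
      (by decide) (by decide) (by decide +kernel) (by decide +kernel) (by decide +kernel)

theorem isConnected_of_mem_connectedLists : ∀ l ∈ connectedLists,
    IsConnected (fractalSquare 3 (digitSet l)) := by
  have h : ∀ l ∈ connectedLists, (digitSet l).Nonempty ∧ ∀ A ∈ (digitSet l).powerset, A.Nonempty →
      (∀ d ∈ A, ∀ e ∈ digitSet l, AdjacentDigits (digitSet l) d e → e ∈ A) → A = digitSet l := by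
    decide +kernel
  exact fun l hl => isConnected_fractalSquare (h l hl).1 (h l hl).2

end Certificates

/-! ### Classification of the five-digit sets -/

section Classification

/-- The symmetries of the square. -/
def squareSymmetries : List (ℤ × ℤ × ℤ × ℤ × ℤ × ℤ) := [
  (1, 0, 0, 1, 0, 0), (-1, 0, 0, 1, 2, 0), (1, 0, 0, -1, 0, 2), (-1, 0, 0, -1, 2, 2),
  (0, 1, 1, 0, 0, 0), (0, -1, 1, 0, 2, 0), (0, 1, -1, 0, 0, 2), (0, -1, -1, 0, 2, 2)]

/-- Digit lists which are affinely equivalent to other ones without being symmetric to them. -/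
def skewLists : List (List (Fin 3 × Fin 3)) := [
  [(0, 0), (0, 1), (1, 0), (1, 1), (2, 2)], [(0, 0), (0, 1), (1, 1), (1, 2), (2, 2)],
  [(0, 0), (0, 1), (1, 1), (2, 1), (2, 2)]]

/-- The list of the digits of `D6`. -/
def diagonalList : List (Fin 3 × Fin 3) := [(0, 0), (1, 1), (2, 2), (1, 0), (0, 2)]

/-- Digit lists representing all digit sets with five elements up to symmetry. -/
def symmetryLists : List (List (Fin 3 × Fin 3)) :=
  rowLists ++ cantorLists ++ connectedLists ++ skewLists ++ [diagonalList]

/-- This is a finite check over the 126 digit sets and the eight symmetries. -/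
theorem exists_symmetryList : ∀ D ∈ Finset.powersetCard 5 (Finset.univ : Finset (Fin 3 × Fin 3)),
    ∃ l ∈ symmetryLists, ∃ M ∈ squareSymmetries, ∀ d ∈ D, ∃ e ∈ l,
      intAffineMap M (digitVec d) = digitVec e := by
  decide +kernel

theorem card_symmetryLists : ∀ l ∈ symmetryLists, (digitSet l).card = 5 := by decide +kernel

theorem nonempty_homeomorph_digitSet {D : Finset (Fin 3 × Fin 3)} (hD : D.card = 5)
    {l : List (Fin 3 × Fin 3)} (hl : l ∈ symmetryLists) {M : ℤ × ℤ × ℤ × ℤ × ℤ × ℤ}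
    (hM : M.1 * M.2.2.2.1 - M.2.1 * M.2.2.1 ≠ 0)
    (h : ∀ d ∈ D, ∃ e ∈ l, intAffineMap M (digitVec d) = digitVec e) :
    Nonempty (fractalSquare 3 D ≃ₜ fractalSquare 3 (digitSet l)) := by
  refine nonempty_homeomorph_of_intAffineMap (Finset.card_pos.1 (by omega)) hM
    ((card_symmetryLists l hl).trans hD.symm) fun d hd => ?_
  obtain ⟨e, he, hde⟩ := h d hd
  exact ⟨e, List.mem_toFinset.2 he, hde⟩

theorem exists_homeomorph_digitSet {D : Finset (Fin 3 × Fin 3)} (hD : D.card = 5) :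
    ∃ l ∈ rowLists ++ cantorLists ++ connectedLists ++ [diagonalList],
      Nonempty (fractalSquare 3 D ≃ₜ fractalSquare 3 (digitSet l)) := by
  obtain ⟨l, hl, M, hM, h⟩ := exists_symmetryList D
    (Finset.mem_powersetCard.2 ⟨Finset.subset_univ D, hD⟩)
  have hdet : ∀ M ∈ squareSymmetries, M.1 * M.2.2.2.1 - M.2.1 * M.2.2.1 ≠ 0 := by decide
  obtain ⟨f⟩ := nonempty_homeomorph_digitSet hD hl (hdet M hM) h
  by_cases hskew : l ∈ skewLists
  · have hs : ∀ l ∈ skewLists, ∃ l' ∈ rowLists ++ cantorLists ++ connectedLists ++ [diagonalList],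
        l' ∈ symmetryLists ∧ ∃ M ∈ ([(0, 1, -1, 1, 0, 1), (0, -1, 1, -1, 2, 1),
          (-1, 1, 0, -1, 1, 2)] : List (ℤ × ℤ × ℤ × ℤ × ℤ × ℤ)),
        M.1 * M.2.2.2.1 - M.2.1 * M.2.2.1 ≠ 0 ∧
        ∀ d ∈ digitSet l, ∃ e ∈ l', intAffineMap M (digitVec d) = digitVec e := by
      decide +kernel
    obtain ⟨l', hl', hl'', M', -, hM', h'⟩ := hs l hskew
    obtain ⟨g⟩ := nonempty_homeomorph_digitSet (card_symmetryLists l hl) hl'' hM' h'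
    exact ⟨l', hl', ⟨f.trans g⟩⟩
  · refine ⟨l, ?_, ⟨f⟩⟩
    simp only [symmetryLists, List.mem_append] at hl ⊢
    tauto

theorem compactSpace_fractalSquare {l : List (Fin 3 × Fin 3)} (hl : l ≠ []) :
    CompactSpace (fractalSquare 3 (digitSet l)) :=
  isCompact_iff_compactSpace.1 (isCompact_fractalSquare (List.toFinset_nonempty_iff l |>.2 hl))

theorem nonempty_subtype_fractalSquare {l : List (Fin 3 × Fin 3)} (hl : l ≠ []) :
    Nonempty (fractalSquare 3 (digitSet l)) :=
  (nonempty_fractalSquare (List.toFinset_nonempty_iff l |>.2 hl)).to_subtype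

theorem nonempty_homeomorph_of_mem_rowLists {l m : List (Fin 3 × Fin 3)} (hl : l ∈ rowLists)
    (hm : m ∈ rowLists) :
    Nonempty (fractalSquare 3 (digitSet l) ≃ₜ fractalSquare 3 (digitSet m)) := by
  have h : ∀ l ∈ rowLists, l ≠ [] := by decide
  have := compactSpace_fractalSquare (h l hl)
  have := compactSpace_fractalSquare (h m hm)
  have := nonempty_subtype_fractalSquare (h l hl)
  have := nonempty_subtype_fractalSquare (h m hm)
  exact (isDecorated_of_mem_rowLists l hl).nonempty_homeomorph (isDecorated_of_mem_rowLists m hm)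

theorem nonempty_homeomorph_of_mem_cantorLists {l m : List (Fin 3 × Fin 3)}
    (hl : l ∈ cantorLists) (hm : m ∈ cantorLists) :
    Nonempty (fractalSquare 3 (digitSet l) ≃ₜ fractalSquare 3 (digitSet m)) := by
  have h : ∀ l ∈ cantorLists, l ≠ [] := by decide
  have hn : ∀ l ∈ cantorLists, (digitSet l).Nontrivial := fun l hl =>
    Finset.one_lt_card_iff_nontrivial.1 (by
      rw [card_symmetryLists l (by simp [symmetryLists, hl])]; norm_num)
  have := compactSpace_fractalSquare (h l hl)
  have := compactSpace_fractalSquare (h m hm)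
  have := nonempty_subtype_fractalSquare (h l hl)
  have := nonempty_subtype_fractalSquare (h m hm)
  have := totallyDisconnectedSpace_of_mem_cantorLists l hl
  have := totallyDisconnectedSpace_of_mem_cantorLists m hm
  exact (isDecorated_unit_fractalSquare (hn l hl)).nonempty_homeomorph
    (isDecorated_unit_fractalSquare (hn m hm))

theorem not_hasPointComponent {K : Set Plane} (hK : IsPreconnected K) (hn : K.Nontrivial) :
    ¬ HasPointComponent K := by
  rintro ⟨x, hx, h⟩
  have hsub := hK.subset_connectedComponentIn hx Subset.rfl
  rw [h] at hsub
  exact hn.not_subset_singleton hsub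

theorem not_hasSegmentComponent {K : Set Plane} [TotallyDisconnectedSpace K] :
    ¬ HasSegmentComponent K := by
  rintro ⟨x, hx, a, b, hab, h⟩
  have hK : IsTotallyDisconnected K := totallyDisconnectedSpace_subtype_iff.1 inferInstance
  have hs := hK _ (connectedComponentIn_subset K x) isPreconnected_connectedComponentIn
  rw [h] at hs
  exact hab (hs (left_mem_segment ℝ a b) (right_mem_segment ℝ a b))

/-- The digit lists representing the topological classes. -/
def classLists : List (List (Fin 3 × Fin 3)) := connectedLists ++ [
  [(0, 0), (0, 1), (1, 2), (2, 0), (2, 1)], [(0, 0), (0, 2), (1, 0), (1, 2), (2, 0)], diagonalList]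

theorem exists_classList {D : Finset (Fin 3 × Fin 3)} (hD : D.card = 5) :
    ∃ l ∈ classLists, Nonempty (fractalSquare 3 D ≃ₜ fractalSquare 3 (digitSet l)) := by
  obtain ⟨l, hl, ⟨f⟩⟩ := exists_homeomorph_digitSet hD
  simp only [List.mem_append, List.mem_singleton] at hl
  rcases hl with ((hl | hl) | hl) | rfl
  · obtain ⟨g⟩ := nonempty_homeomorph_of_mem_rowLists hl
      (m := [(0, 0), (0, 2), (1, 0), (1, 2), (2, 0)]) (by decide)
    exact ⟨_, by decide, ⟨f.trans g⟩⟩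
  · obtain ⟨g⟩ := nonempty_homeomorph_of_mem_cantorLists hl
      (m := [(0, 0), (0, 1), (1, 2), (2, 0), (2, 1)]) (by decide)
    exact ⟨_, by decide, ⟨f.trans g⟩⟩
  · exact ⟨l, List.mem_append_left _ hl, ⟨f⟩⟩
  · exact ⟨_, by decide, ⟨f⟩⟩

/-- The eight representative lists map onto the set of classes. -/
theorem chi_five_le : chi 5 ≤ 8 := by
  have hcard : ∀ l ∈ classLists, (digitSet l).card = 5 := by decide +kernel
  let f : {l // l ∈ classLists.toFinset} → Quotient (topEquiv (orderThreeFamily 5)) := fun l =>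
    Quotient.mk _ ⟨fractalSquare 3 (digitSet l.1), digitSet l.1,
      hcard l.1 (List.mem_toFinset.1 l.2), rfl⟩
  have hf : Function.Surjective f := by
    refine Quotient.ind ?_
    rintro ⟨_, D, hD, rfl⟩
    obtain ⟨l, hl, ⟨g⟩⟩ := exists_classList hD
    exact ⟨⟨l, List.mem_toFinset.2 hl⟩, Quotient.sound ⟨g.symm⟩⟩
  refine (ENat.card_le_card_of_injective (Function.injective_surjInv hf)).trans ?_
  rw [ENat.card_eq_coe_fintype_card, Fintype.card_coe]
  exact_mod_cast (List.toFinset_card_le classLists)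

end Classification

/-! ### Conclusion -/

theorem mainTheorem2 :
    (∀ D : Finset (Fin 3 × Fin 3), D.card = 5 →
      HasPointComponent (fractalSquare 3 D) → HasSegmentComponent (fractalSquare 3 D) →
      ∃ E : Finset (Fin 3 × Fin 3), (E = D4 ∨ E = D5 ∨ E = D6 ∨ E = D7) ∧
        Nonempty (fractalSquare 3 D ≃ₜ fractalSquare 3 E)) ∧
    chi 5 ≤ 8 := by
  refine ⟨fun D hD hpoint hsegment => ?_, chi_five_le⟩
  obtain ⟨l, hl, ⟨f⟩⟩ := exists_homeomorph_digitSet hD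
  simp only [List.mem_append, List.mem_singleton] at hl
  rcases hl with ((hl | hl) | hl) | rfl
  -- All lists with a full row give one class, for which `D4` is taken as representative.
  · obtain ⟨g⟩ := nonempty_homeomorph_of_mem_rowLists hl
      (m := [(0, 0), (0, 2), (1, 0), (1, 2), (2, 0)]) (by decide)
    exact ⟨_, Or.inl (by decide), ⟨f.trans g⟩⟩
  · have := totallyDisconnectedSpace_of_mem_cantorLists l hl
    have := f.symm.totallyDisconnectedSpace
    exact absurd hsegment not_hasSegmentComponent
  · have := isConnected_iff_connectedSpace.1 (isConnected_of_mem_connectedLists l hl)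
    have := f.symm.surjective.connectedSpace f.symm.continuous
    refine absurd hpoint (not_hasPointComponent (isConnected_iff_connectedSpace.2 this).2
      (nontrivial_fractalSquare (Finset.one_lt_card_iff_nontrivial.1 (by omega))))
  -- The remaining representative is `D6` itself, so nothing about its components is needed.
  · exact ⟨_, Or.inr (Or.inr (Or.inl (by decide))), ⟨f⟩⟩
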